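/- Let $G$ be an infinite group, let $S$ be a finite subset of $G$ that generates $G$, and let $p$ be a prime number. Suppose that the commutator subgroup $G' = \langle xyx^{-1}y^{-1} \mid x, y \in G\rangle$ of $G$ is isomorphic to $\mathbb{Z}_p$, the cyclic group of order $p$. Let $\mathrm{Cay}(G;S)$ be the Cayley graph of $G$ with respect to $S$: the simple undirected graph with vertex set $G$ in which two distinct vertices $u, v$ are adjacent if and only if $v = us$ or $u = vs$ for some $s \in S$. Then $\mathrm{Cay}(G;S)$ has a two-way hamiltonian path, that is, there is a two-way infinite list $\ldots, x_{-2}, x_{-1}, x_0, x_1, x_2, \ldots$ containing every element of $G$ exactly once such that $x_i$ is adjacent to $x_{i+1}$ in $\mathrm{Cay}(G;S)$ for every $i \in \mathbb{Z}$. -/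

import Mathlib

/-- A two-way hamiltonian path in a graph `X`: a two-way infinite list
`…, x₋₂, x₋₁, x₀, x₁, x₂, …` containing each vertex of `X` exactly once,
such that `xᵢ` is adjacent to `xᵢ₊₁` for each `i`. -/
def IsTwoWayHamiltonianPath {V : Type*} (X : SimpleGraph V) (x : ℤ → V) : Prop :=
  (∀ v : V, ∃! i : ℤ, x i = v) ∧ ∀ i : ℤ, X.Adj (x i) (x (i + 1))

/-!
The group `A = G/G'` is infinite, and `G → A` has kernel `G'` of prime order `p`. Consider a closed
walk in the Cayley graph of `A` that runs once through every vertex of a set `X`. If its word is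
nontrivial in `G` (a *twisted cycle*, `IsTwistedCycle`), then it represents a generator of `G'`.
Hence its `p`-fold repetition lifts to a hamiltonian cycle of the preimage of `X` in `G`, and the
preimage can be traversed by a path between lifts of the two ends of any edge of the cycle
(`IsTwistedCycle.trav`).

Two-way hamiltonian paths are obtained by tiling `A` with translates of such a set `X`, indexed by
a graph that itself has a two-way hamiltonian path, and passing greedily from block to block through
suitable ports (`exists_twoWay_of_tiles`, `exists_twoWay_of_int_tiles`). The index graphs are
products of finite paths and two-way infinite paths (`exists_twoWay_boxProd`), obtained by adjoining
the generators to a subgroup of `A` one at a time (`exists_traceable_transversal`).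

It remains to find the blocks. Since `G'` is nontrivial, there are noncommuting generators `s` and
`t`. Orders below, and the subgroups `⟨t⟩` and `⟨s, t⟩`, are taken in `A`.

* If a generator `t` has finite order `m` and `t ^ m ≠ 1`, the block is `⟨t⟩`
  (`exists_twoWay_of_pow_orderOf_ne_one`). Otherwise `t ^ m = 1` for all of them.
* If `s` has infinite and `t` finite order, the block is `⟨t⟩ ∪ ⟨t⟩ * s`
  (`exists_twoWay_of_infinite_order_of_finite_order`).
* If both orders are finite, take a generator `z` of infinite order. It may be assumed to commute
  with `s` and `t`, and the block is `F ∪ F * z` with `F = ⟨s, t⟩`, traced by a walk that zigzags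
  between the two cosets (`exists_twoWay_of_lollipop`).
* If both orders are infinite and `t` has even or infinite order modulo `s`, the commutator of `s`
  and `t` traces the block `{1, s, s * t, t}` (`exists_twoWay_of_even_of_not_commute`). If the order
  `m` of `t` modulo `s` is odd, then `t ^ m = s ^ k` in `A`, with `k > 0` after possibly inverting
  `s`, and a word with `m` letters `t` and `k` letters `s⁻¹` is a twisted cycle through a tile of
  `H = ⟨s, t⟩` modulo the powers of `t * s`. If all generators have odd order modulo `H`, its index
  is odd, and an odd number of copies of the tile, run through one after the other, form a block
  (`exists_twoWay_of_odd_index`). Otherwise a generator of even or infinite order modulo `H` gives a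
  block shaped like a square (`exists_twoWay_of_odd_of_pow_eq_pow`).
-/

open SimpleGraph

/-! ### Concatenating finite paths -/

/-- Finite `R`-chains `ℓ 0, ℓ 1, …`, pairwise disjoint and linked end to head, concatenate to an
injective sequence whose consecutive terms are `R`-related. -/
theorem exists_seq_of_lists {V : Type*} {R : V → V → Prop} (ℓ : ℕ → List V)
    (hne : ∀ k, ℓ k ≠ []) (hch : ∀ k, (ℓ k).IsChain R)
    (hlink : ∀ k, ∀ a ∈ (ℓ k).getLast?, ∀ b ∈ (ℓ (k + 1)).head?, R a b)
    (hnd : ∀ k, (ℓ k).Nodup) (hdisj : ∀ j k v, v ∈ ℓ j → v ∈ ℓ k → j = k) :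
    ∃ f : ℕ → V, Function.Injective f ∧ (∀ v, (∃ n, f n = v) ↔ ∃ k, v ∈ ℓ k) ∧
      (∀ n, R (f n) (f (n + 1))) ∧ f 0 ∈ (ℓ 0).head? := by
  set P : ℕ → List V := fun n => (List.range n).flatMap ℓ with hP
  have hPs : ∀ n, P (n + 1) = P n ++ ℓ n := by
    intro n; simp [hP, List.range_succ, List.flatMap_append]
  have hpre : ∀ m n, m ≤ n → P m <+: P n := by
    intro m n h
    induction h with
    | refl => exact List.prefix_rfl
    | step _ ih => exact ih.trans (by rw [hPs]; exact List.prefix_append _ _)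
  have hlen : ∀ n, n ≤ (P n).length := by
    intro n
    induction n with
    | zero => simp
    | succ n ih =>
      rw [hPs, List.length_append]
      have := List.length_pos_iff.mpr (hne n)
      omega
  have hmem : ∀ n v, v ∈ P n ↔ ∃ k < n, v ∈ ℓ k := by
    intro n v; simp [hP, List.mem_flatMap]
  have hPnd : ∀ n, (P n).Nodup := by
    intro n
    induction n with
    | zero => simp [hP]
    | succ n ih =>
      rw [hPs, List.nodup_append']
      refine ⟨ih, hnd n, fun v h1 h2 => ?_⟩
      obtain ⟨k, hk, hv⟩ := (hmem _ _).1 h1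
      have := hdisj _ _ _ hv h2
      omega
  have hPch : ∀ n, (P n).IsChain R := by
    intro n
    induction n with
    | zero => simp [hP]
    | succ n ih =>
      rw [hPs, List.isChain_append]
      refine ⟨ih, hch n, fun a ha b hb => ?_⟩
      cases n with
      | zero => simp [hP] at ha
      | succ n =>
        rw [hPs, List.getLast?_append_of_ne_nil _ (hne n)] at ha
        exact hlink n a ha b hb
  have hlt : ∀ n, n < (P (n + 1)).length := fun n => hlen (n + 1)
  set f : ℕ → V := fun n => (P (n + 1))[n]'(hlt n) with hf
  have key : ∀ m n (h : n < (P m).length), (P m)[n] = f n := by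
    intro m n h
    rcases le_total m (n + 1) with h' | h'
    · exact (hpre _ _ h').getElem h
    · exact ((hpre _ _ h').getElem (hlt n)).symm
  refine ⟨f, ?_, ?_, ?_, ?_⟩
  · intro a b hab
    have ha : a < (P (max a b + 1)).length := by have := hlen (max a b + 1); omega
    have hb : b < (P (max a b + 1)).length := by have := hlen (max a b + 1); omega
    rw [← key _ a ha, ← key _ b hb] at hab
    exact (List.Nodup.getElem_inj_iff (hPnd _)).1 hab
  · intro v
    constructor
    · rintro ⟨n, rfl⟩
      obtain ⟨k, -, hk⟩ := (hmem (n + 1) (f n)).1 (List.getElem_mem _)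
      exact ⟨k, hk⟩
    · rintro ⟨k, hk⟩
      have : v ∈ P (k + 1) := (hmem _ _).2 ⟨k, by omega, hk⟩
      obtain ⟨n, hn, rfl⟩ := List.getElem_of_mem this
      exact ⟨n, (key _ _ hn).symm⟩
  · intro n
    have h2 : n + 1 < (P (n + 1 + 1)).length := hlt (n + 1)
    rw [← key (n + 1 + 1) n (by omega), ← key (n + 1 + 1) (n + 1) h2]
    exact (hPch _).getElem n h2
  · have h1 : P 1 = ℓ 0 := by simp [hP]
    have h0 : 0 < (P 1).length := hlt 0
    rw [← key 1 0 h0]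
    have h0' : 0 < (ℓ 0).length := by rw [← h1]; exact h0
    simp only [h1]
    rw [Option.mem_def, List.head?_eq_getElem?]
    exact List.getElem?_eq_getElem h0'

/-- Two disjoint one-way infinite concatenations that start at adjacent vertices and together
cover everything form a two-way infinite path. -/
theorem exists_twoWay_of_lists {V : Type*} {X : SimpleGraph V} {R : V → V → Prop}
    (hR : ∀ a b, a ≠ b → R a b → X.Adj a b) (ℓ ℓ' : ℕ → List V)
    (hne : ∀ k, ℓ k ≠ []) (hch : ∀ k, (ℓ k).IsChain R)
    (hlink : ∀ k, ∀ a ∈ (ℓ k).getLast?, ∀ b ∈ (ℓ (k + 1)).head?, R a b)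
    (hnd : ∀ k, (ℓ k).Nodup) (hdisj : ∀ j k v, v ∈ ℓ j → v ∈ ℓ k → j = k)
    (hne' : ∀ k, ℓ' k ≠ []) (hch' : ∀ k, (ℓ' k).IsChain R)
    (hlink' : ∀ k, ∀ a ∈ (ℓ' k).getLast?, ∀ b ∈ (ℓ' (k + 1)).head?, R a b)
    (hnd' : ∀ k, (ℓ' k).Nodup) (hdisj' : ∀ j k v, v ∈ ℓ' j → v ∈ ℓ' k → j = k)
    (hdd : ∀ j k v, v ∈ ℓ j → v ∈ ℓ' k → False)
    (hcov : ∀ v, (∃ k, v ∈ ℓ k) ∨ ∃ k, v ∈ ℓ' k)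
    (hstart : ∀ a ∈ (ℓ 0).head?, ∀ b ∈ (ℓ' 0).head?, R a b) :
    ∃ x : ℤ → V, IsTwoWayHamiltonianPath X x := by
  obtain ⟨f, hfi, hfr, hfR, hf0⟩ := exists_seq_of_lists ℓ hne hch hlink hnd hdisj
  obtain ⟨g, hgi, hgr, hgR, hg0⟩ := exists_seq_of_lists ℓ' hne' hch' hlink' hnd' hdisj'
  have hfg : ∀ m n, f m ≠ g n := by
    intro m n h
    obtain ⟨j, hj⟩ := (hfr (f m)).1 ⟨m, rfl⟩
    obtain ⟨k, hk⟩ := (hgr (g n)).1 ⟨n, rfl⟩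
    exact hdd j k _ hj (h ▸ hk)
  set x : ℤ → V := fun i => match i with
    | Int.ofNat n => f n
    | Int.negSucc n => g n with hx
  refine ⟨x, ?_, ?_⟩
  · intro v
    rcases hcov v with h | h
    · obtain ⟨n, rfl⟩ := (hfr v).2 h
      refine ⟨Int.ofNat n, rfl, ?_⟩
      rintro (m | m) hm
      · exact congrArg _ (hfi hm)
      · exact absurd hm.symm (hfg n m)
    · obtain ⟨n, rfl⟩ := (hgr v).2 h
      refine ⟨Int.negSucc n, rfl, ?_⟩
      rintro (m | m) hm
      · exact absurd hm (hfg m n)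
      · exact congrArg _ (hgi hm)
  · rintro (n | n)
    · exact show X.Adj (f n) (f (n + 1)) from
        hR _ _ (fun h => absurd (hfi h) (by omega)) (hfR n)
    · cases n with
      | zero => exact (hR _ _ (hfg 0 0) (hstart _ hf0 _ hg0)).symm
      | succ n =>
        have h1 : Int.negSucc (n + 1) + 1 = Int.negSucc n := by omega
        rw [h1]
        exact show X.Adj (g (n + 1)) (g n) from
          (hR _ _ (fun h => absurd (hgi h) (by omega)) (hgR n)).symm

/-! ### Hamiltonian paths in products of graphs -/

/-- A finite list running once through every vertex along edges: a finite hamiltonian path. -/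
def IsHamiltonianList {V : Type*} (P : SimpleGraph V) (l : List V) : Prop :=
  l ≠ [] ∧ l.Nodup ∧ l.IsChain P.Adj ∧ ∀ v, v ∈ l

/-- A graph is traceable if it has a hamiltonian path that is either finite or two-way infinite. -/
def Traceable {V : Type*} (P : SimpleGraph V) : Prop :=
  (∃ x : ℤ → V, IsTwoWayHamiltonianPath P x) ∨ ∃ l : List V, IsHamiltonianList P l

theorem IsTwoWayHamiltonianPath.injective {V : Type*} {P : SimpleGraph V} {x : ℤ → V}
    (h : IsTwoWayHamiltonianPath P x) : Function.Injective x := fun _ j hij =>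
  (h.1 (x j)).unique hij rfl

theorem IsTwoWayHamiltonianPath.surjective {V : Type*} {P : SimpleGraph V} {x : ℤ → V}
    (h : IsTwoWayHamiltonianPath P x) : Function.Surjective x := fun v => (h.1 v).exists

theorem IsTwoWayHamiltonianPath.adj_of_eq {V : Type*} {P : SimpleGraph V} {x : ℤ → V}
    (h : IsTwoWayHamiltonianPath P x) {i j : ℤ} (hij : i = j + 1 ∨ j = i + 1) :
    P.Adj (x i) (x j) := by
  rcases hij with rfl | rfl
  · exact (h.2 j).symm
  · exact h.2 i

theorem IsTwoWayHamiltonianPath.map_iso {V W : Type*} {P : SimpleGraph V} {Q : SimpleGraph W}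
    {x : ℤ → V} (h : IsTwoWayHamiltonianPath P x) (e : P ≃g Q) :
    IsTwoWayHamiltonianPath Q (e ∘ x) := by
  refine ⟨fun v => ?_, fun i => e.map_adj_iff.2 (h.2 i)⟩
  obtain ⟨i, hi, hu⟩ := h.1 (e.symm v)
  refine ⟨i, by simp [hi], fun j hj => hu j ?_⟩
  rw [← hj]; simp

theorem IsHamiltonianList.reverse {V : Type*} {P : SimpleGraph V} {l : List V}
    (h : IsHamiltonianList P l) : IsHamiltonianList P l.reverse := by
  refine ⟨by simpa using h.1, by simpa using h.2.1, ?_, by simpa using h.2.2.2⟩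
  rw [List.isChain_reverse]
  exact h.2.2.1.imp fun _ _ hab => hab.symm

/-- The points, in order, of the `k`-th of the nested U-shaped paths that fill a half-plane: up the
side `(±k, 0), …, (±k, k)`, across to `(∓k, k)`, and down to `(∓k, 0)`, where the sign alternates
with `k`. -/
def uPath (k n : ℕ) : ℤ × ℤ :=
  let σ : ℤ := if Even k then 1 else -1
  if n ≤ k then (σ * k, n) else if n ≤ 3 * k then (σ * (2 * k - n), k) else (-(σ * k), 4 * k - n)

theorem uPath_step (k n : ℕ) (h : n + 1 ≤ 4 * k) :
    ((uPath k n).1 = (uPath k (n + 1)).1 ∧ ((uPath k n).2 = (uPath k (n + 1)).2 + 1 ∨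
      (uPath k (n + 1)).2 = (uPath k n).2 + 1)) ∨
    ((uPath k n).2 = (uPath k (n + 1)).2 ∧ ((uPath k n).1 = (uPath k (n + 1)).1 + 1 ∨
      (uPath k (n + 1)).1 = (uPath k n).1 + 1)) := by
  unfold uPath
  by_cases hk : Even k <;> simp only [hk, if_true, if_false] <;> split_ifs <;> push_cast <;> omega

theorem uPath_link (k : ℕ) : (uPath k (4 * k)).2 = (uPath (k + 1) 0).2 ∧
    ((uPath k (4 * k)).1 = (uPath (k + 1) 0).1 + 1 ∨
      (uPath (k + 1) 0).1 = (uPath k (4 * k)).1 + 1) := by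
  unfold uPath
  by_cases hk : Even k <;> simp only [hk, Nat.even_add_one, not_true, not_false_iff,
    if_true, if_false] <;> split_ifs <;> push_cast <;> omega

theorem uPath_inj {j k m n : ℕ} (hm : m ≤ 4 * j) (hn : n ≤ 4 * k) (h : uPath j m = uPath k n) :
    j = k ∧ m = n := by
  have hjk : j = k := by
    unfold uPath at h
    by_cases hj : Even j <;> by_cases hk : Even k <;>
      simp only [hj, hk, if_true, if_false] at h <;> split_ifs at h <;>
      simp only [Prod.mk.injEq] at h <;> omega
  subst hjk
  refine ⟨rfl, ?_⟩
  unfold uPath at h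
  by_cases hj : Even j <;>
    simp only [hj, if_true, if_false] at h <;> split_ifs at h <;>
    simp only [Prod.mk.injEq] at h <;> omega

theorem uPath_nonneg {k n : ℕ} (hn : n ≤ 4 * k) : 0 ≤ (uPath k n).2 := by
  unfold uPath
  split_ifs <;> push_cast <;> omega

theorem uPath_surj (a b : ℤ) (hb : 0 ≤ b) : ∃ k n, n ≤ 4 * k ∧ uPath k n = (a, b) := by
  obtain ⟨k, hk⟩ : ∃ k : ℕ, (k : ℤ) = max (max a (-a)) b :=
    ⟨(max (max a (-a)) b).toNat, by omega⟩
  refine ⟨k, ?_⟩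
  by_cases he : Even k
  · by_cases h1 : a = k
    · exact ⟨b.toNat, by omega, by
        unfold uPath; rw [if_pos he, if_pos (by omega)]; ext <;> simp <;> omega⟩
    by_cases h2 : b = k
    · exact ⟨(2 * k - a).toNat, by omega, by
        unfold uPath; rw [if_pos he, if_neg (by omega), if_pos (by omega)]
        ext <;> simp <;> omega⟩
    · exact ⟨(4 * k - b).toNat, by omega, by
        unfold uPath; rw [if_pos he, if_neg (by omega), if_neg (by omega)]
        ext <;> simp <;> omega⟩
  · by_cases h1 : a = -k
    · exact ⟨b.toNat, by omega, by
        unfold uPath; rw [if_neg he, if_pos (by omega)]; ext <;> simp <;> omega⟩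
    by_cases h2 : b = k
    · exact ⟨(2 * k + a).toNat, by omega, by
        unfold uPath; rw [if_neg he, if_neg (by omega), if_pos (by omega)]
        ext <;> simp <;> omega⟩
    · exact ⟨(4 * k - b).toNat, by omega, by
        unfold uPath; rw [if_neg he, if_neg (by omega), if_neg (by omega)]
        ext <;> simp <;> omega⟩


/-- Two half-planes, each filled by nested U-shaped paths, joined at their starting points. -/
theorem exists_twoWay_boxProd_of_twoWay {V W : Type*} {P : SimpleGraph V} {Q : SimpleGraph W}
    {x : ℤ → V} {y : ℤ → W} (hx : IsTwoWayHamiltonianPath P x)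
    (hy : IsTwoWayHamiltonianPath Q y) :
    ∃ z : ℤ → V × W, IsTwoWayHamiltonianPath (P □ Q) z := by
  -- the upper half-plane is `y 0, y 1, …`, the lower one `y (-1), y (-2), …`
  have main : ∀ φ : ℤ → ℤ, (∀ b c, b = c + 1 ∨ c = b + 1 → φ b = φ c + 1 ∨ φ c = φ b + 1) →
      Function.Injective φ →
      let ℓ : ℕ → List (V × W) := fun k => (List.range (4 * k + 1)).map
        fun n => (x (uPath k n).1, y (φ (uPath k n).2))
      (∀ k, ℓ k ≠ []) ∧ (∀ k, (ℓ k).IsChain (P □ Q).Adj) ∧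
      (∀ k, ∀ a ∈ (ℓ k).getLast?, ∀ b ∈ (ℓ (k + 1)).head?, (P □ Q).Adj a b) ∧
      (∀ k, (ℓ k).Nodup) ∧ (∀ j k v, v ∈ ℓ j → v ∈ ℓ k → j = k) ∧
      (∀ v, (∃ k, v ∈ ℓ k) ↔ ∃ a b, 0 ≤ b ∧ v = (x a, y (φ b))) ∧
      (∀ v ∈ (ℓ 0).head?, v = (x 0, y (φ 0))) := by
    intro φ hφ hφi ℓ
    have hinj : ∀ p q : ℤ × ℤ, (x p.1, y (φ p.2)) = (x q.1, y (φ q.2)) → p = q := by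
      intro p q h
      rw [Prod.mk.injEq] at h
      exact Prod.ext (hx.injective h.1) (hφi (hy.injective h.2))
    refine ⟨fun k => by simp [ℓ], fun k => ?_, fun k a ha b hb => ?_, fun k => ?_, ?_, ?_, ?_⟩
    · rw [List.isChain_iff_getElem]
      intro i hi
      simp only [ℓ, List.length_map, List.length_range] at hi
      simp only [ℓ, List.getElem_map, List.getElem_range, boxProd_adj]
      rcases uPath_step k i (by omega) with ⟨h1, h2⟩ | ⟨h1, h2⟩
      · exact Or.inr ⟨hy.adj_of_eq (hφ _ _ h2), by rw [h1]⟩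
      · exact Or.inl ⟨hx.adj_of_eq h2, by rw [h1]⟩
    · simp only [ℓ, List.range_succ, List.map_append, List.map_cons, List.map_nil,
        List.getLast?_append, List.getLast?_singleton, Option.some_or, Option.mem_def,
        Option.some.injEq] at ha
      rw [List.head?_eq_getElem?] at hb
      simp only [ℓ, Option.mem_def, List.getElem?_map, List.getElem?_range (Nat.succ_pos _),
        Option.map_some, Option.some.injEq] at hb
      subst ha hb
      obtain ⟨h1, h2⟩ := uPath_link k
      exact Or.inl ⟨hx.adj_of_eq h2, by rw [h1]⟩
    · refine List.Nodup.map_on ?_ List.nodup_range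
      intro m hm n hn h
      rw [List.mem_range] at hm hn
      exact (uPath_inj (by omega) (by omega) (hinj _ _ h)).2
    · intro j k v hj hk
      simp only [ℓ, List.mem_map, List.mem_range] at hj hk
      obtain ⟨m, hm, rfl⟩ := hj
      obtain ⟨n, hn, h⟩ := hk
      exact (uPath_inj (by omega) (by omega) (hinj _ _ h)).1.symm
    · intro v
      constructor
      · rintro ⟨k, hk⟩
        simp only [ℓ, List.mem_map, List.mem_range] at hk
        obtain ⟨m, hm, rfl⟩ := hk
        exact ⟨_, _, uPath_nonneg (by omega), rfl⟩
      · rintro ⟨a, b, hb, rfl⟩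
        obtain ⟨k, n, hn, h⟩ := uPath_surj a b hb
        refine ⟨k, ?_⟩
        simp only [ℓ, List.mem_map, List.mem_range]
        exact ⟨n, by omega, by rw [h]⟩
    · intro v hv
      simp [ℓ, uPath] at hv
      exact hv.symm
  obtain ⟨h1, h2, h3, h4, h5, h6, h7⟩ := main id (fun _ _ h => h) Function.injective_id
  obtain ⟨h1', h2', h3', h4', h5', h6', h7'⟩ := main (fun b => -1 - b)
    (fun _ _ h => by omega) (fun _ _ h => by simpa using h)
  refine exists_twoWay_of_lists (R := (P □ Q).Adj) (fun _ _ _ h => h) _ _ h1 h2 h3 h4 h5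
    h1' h2' h3' h4' h5' ?_ ?_ ?_
  · intro j k v hj hk
    obtain ⟨a, b, hb, rfl⟩ := (h6 v).1 ⟨j, hj⟩
    obtain ⟨c, d, hd, h⟩ := (h6' _).1 ⟨k, hk⟩
    have := hy.injective (Prod.mk.inj h).2
    simp only [id] at this
    omega
  · rintro ⟨v, w⟩
    obtain ⟨a, rfl⟩ := hx.surjective v
    obtain ⟨b, rfl⟩ := hy.surjective w
    rcases le_or_gt 0 b with hb | hb
    · exact Or.inl ((h6 _).2 ⟨a, b, hb, rfl⟩)
    · exact Or.inr ((h6' _).2 ⟨a, -1 - b, by omega, by simp⟩)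
  · intro a ha b hb
    rw [h7 a ha, h7' b hb]
    exact Or.inr ⟨hy.adj_of_eq (by simp), rfl⟩

/-- A snake: the copies of a finite path are run through alternately forwards and backwards. -/
theorem exists_twoWay_boxProd_of_list {V W : Type*} {P : SimpleGraph V} {Q : SimpleGraph W}
    {x : ℤ → V} {l : List W} (hx : IsTwoWayHamiltonianPath P x) (hl : IsHamiltonianList Q l) :
    ∃ z : ℤ → V × W, IsTwoWayHamiltonianPath (P □ Q) z := by
  set d : ℕ → List W := fun k => if Even k then l else l.reverse with hd
  have hdl : ∀ k, IsHamiltonianList Q (d k) := by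
    intro k
    by_cases hk : Even k
    · simpa [hd, hk] using hl
    · simpa [hd, hk] using hl.reverse
  have hdlink : ∀ k, (d k).getLast? = (d (k + 1)).head? := by
    intro k
    by_cases hk : Even k
    · simp [hd, hk, Nat.even_add_one]
    · simp [hd, hk, Nat.even_add_one]
  have main : ∀ φ : ℕ → ℤ, Function.Injective φ →
      (∀ k, φ k = φ (k + 1) + 1 ∨ φ (k + 1) = φ k + 1) →
      let ℓ : ℕ → List (V × W) := fun k => (d k).map fun b => (x (φ k), b)
      (∀ k, ℓ k ≠ []) ∧ (∀ k, (ℓ k).IsChain (P □ Q).Adj) ∧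
      (∀ k, ∀ a ∈ (ℓ k).getLast?, ∀ b ∈ (ℓ (k + 1)).head?, (P □ Q).Adj a b) ∧
      (∀ k, (ℓ k).Nodup) ∧ (∀ j k v, v ∈ ℓ j → v ∈ ℓ k → j = k) := by
    intro φ hφi hφ ℓ
    refine ⟨fun k => by simpa [ℓ] using (hdl k).1, fun k => ?_, fun k a ha b hb => ?_,
      fun k => ?_, ?_⟩
    · exact List.isChain_map_of_isChain _ (fun a b h => boxProd_adj.2 (Or.inr ⟨h, rfl⟩))
        (hdl k).2.2.1
    · simp only [ℓ, List.getLast?_map, List.head?_map, ← hdlink] at ha hb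
      simp only [Option.mem_def, Option.map_eq_some_iff] at ha hb
      obtain ⟨a', ha', rfl⟩ := ha
      obtain ⟨b', hb', rfl⟩ := hb
      have : a' = b' := Option.some_injective _ (ha'.symm.trans hb')
      exact Or.inl ⟨hx.adj_of_eq (hφ k), this⟩
    · exact (hdl k).2.1.map fun a b h => (Prod.mk.inj h).2
    · intro j k v hj hk
      simp only [ℓ, List.mem_map] at hj hk
      obtain ⟨_, _, rfl⟩ := hj
      obtain ⟨_, _, h⟩ := hk
      exact (hφi (hx.injective (Prod.mk.inj h).1)).symm
  obtain ⟨h1, h2, h3, h4, h5⟩ := main (fun k => k) (fun a b h => by simpa using h)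
    (fun k => by simp)
  obtain ⟨h1', h2', h3', h4', h5'⟩ := main (fun k => -1 - k)
    (fun a b h => by simpa using h) (fun k => by push_cast; omega)
  refine exists_twoWay_of_lists (R := (P □ Q).Adj) (fun _ _ _ h => h) _ _ h1 h2 h3 h4 h5
    h1' h2' h3' h4' h5' ?_ ?_ ?_
  · intro j k v hj hk
    simp only [List.mem_map] at hj hk
    obtain ⟨_, _, rfl⟩ := hj
    obtain ⟨_, _, h⟩ := hk
    have := hx.injective (Prod.mk.inj h).1
    omega
  · rintro ⟨v, w⟩
    obtain ⟨a, rfl⟩ := hx.surjective v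
    rcases le_or_gt 0 a with ha | ha
    · refine Or.inl ⟨a.toNat, ?_⟩
      simp only [List.mem_map]
      exact ⟨w, (hdl _).2.2.2 w, by rw [Int.toNat_of_nonneg ha]⟩
    · refine Or.inr ⟨(-1 - a).toNat, ?_⟩
      simp only [List.mem_map]
      exact ⟨w, (hdl _).2.2.2 w, by rw [Int.toNat_of_nonneg (by omega)]; simp⟩
  · intro a ha b hb
    simp only [List.head?_map, Option.mem_def, Option.map_eq_some_iff] at ha hb
    obtain ⟨a', ha', rfl⟩ := ha
    obtain ⟨b', hb', rfl⟩ := hb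
    have : a' = b' := Option.some_injective _ (ha'.symm.trans hb')
    exact Or.inl ⟨hx.adj_of_eq (by simp), this⟩

theorem exists_twoWay_boxProd {V W : Type*} {P : SimpleGraph V} {Q : SimpleGraph W}
    (hP : ∃ x : ℤ → V, IsTwoWayHamiltonianPath P x) (hQ : Traceable Q) :
    ∃ z : ℤ → V × W, IsTwoWayHamiltonianPath (P □ Q) z := by
  obtain ⟨x, hx⟩ := hP
  rcases hQ with ⟨y, hy⟩ | ⟨l, hl⟩
  · exact exists_twoWay_boxProd_of_twoWay hx hy
  · exact exists_twoWay_boxProd_of_list hx hl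

theorem isHamiltonianList_boxProd {V W : Type*} {P : SimpleGraph V} {Q : SimpleGraph W}
    {m : List V} {l : List W} (hm : IsHamiltonianList P m) (hl : IsHamiltonianList Q l) :
    ∃ n, IsHamiltonianList (P □ Q) n := by
  have main : ∀ m : List V, m.Nodup → m.IsChain P.Adj → ∀ l : List W, IsHamiltonianList Q l →
      ∃ n : List (V × W), n.Nodup ∧ n.IsChain (P □ Q).Adj ∧
        (∀ p, p ∈ n ↔ p.1 ∈ m) ∧ ∀ p ∈ n.head?, p.1 ∈ m.head? ∧ p.2 ∈ l.head? := by
    intro m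
    induction m with
    | nil => exact fun _ _ _ _ => ⟨[], by simp⟩
    | cons a m ih =>
      intro hnd hch l hl
      obtain ⟨n, h1, h2, h3, h4⟩ := ih (List.nodup_cons.1 hnd).2 hch.tail _ hl.reverse
      refine ⟨l.map (fun b => (a, b)) ++ n, ?_, ?_, ?_, ?_⟩
      · rw [List.nodup_append']
        refine ⟨hl.2.1.map fun b c h => (Prod.mk.inj h).2, h1, fun p hp hp' => ?_⟩
        obtain ⟨b, -, rfl⟩ := List.mem_map.1 hp
        exact (List.nodup_cons.1 hnd).1 ((h3 _).1 hp')
      · rw [List.isChain_append]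
        refine ⟨List.isChain_map_of_isChain _
          (fun b c h => boxProd_adj.2 (Or.inr ⟨h, rfl⟩)) hl.2.2.1, h2, ?_⟩
        intro p hp q hq
        obtain ⟨h5, h6⟩ := h4 q hq
        simp only [List.getLast?_map, Option.mem_def, Option.map_eq_some_iff] at hp
        obtain ⟨b, hb, rfl⟩ := hp
        rw [List.head?_reverse, Option.mem_def, hb, Option.some.injEq] at h6
        exact Or.inl ⟨hch.rel_head? h5, h6⟩
      · rintro ⟨v, w⟩
        simp only [List.mem_append, List.mem_map, h3, List.mem_cons, Prod.mk.injEq]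
        constructor
        · rintro (⟨b, -, rfl, -⟩ | h)
          · exact Or.inl rfl
          · exact Or.inr h
        · rintro (rfl | h)
          · exact Or.inl ⟨w, hl.2.2.2 w, rfl, rfl⟩
          · exact Or.inr h
      · intro p hp
        rw [List.head?_append_of_ne_nil _ (by simpa using hl.1)] at hp
        simp only [List.head?_map, Option.mem_def, Option.map_eq_some_iff] at hp
        obtain ⟨b, hb, rfl⟩ := hp
        exact ⟨by simp, hb⟩
  obtain ⟨n, h1, h2, h3, -⟩ := main m hm.2.1 hm.2.2.1 l hl
  obtain ⟨v, hv⟩ := List.exists_mem_of_ne_nil _ hm.1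
  obtain ⟨w, hw⟩ := List.exists_mem_of_ne_nil _ hl.1
  exact ⟨n, List.ne_nil_of_mem ((h3 (v, w)).2 hv), h1, h2, fun p => (h3 p).2 (hm.2.2.2 _)⟩

theorem Traceable.boxProd {V W : Type*} {P : SimpleGraph V} {Q : SimpleGraph W}
    (hP : Traceable P) (hQ : Traceable Q) : Traceable (P □ Q) := by
  rcases hP with hP | ⟨m, hm⟩
  · exact Or.inl (exists_twoWay_boxProd hP hQ)
  rcases hQ with ⟨y, hy⟩ | ⟨l, hl⟩
  · obtain ⟨z, hz⟩ := exists_twoWay_boxProd_of_list hy hm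
    exact Or.inl ⟨_, hz.map_iso (boxProdComm Q P)⟩
  · exact Or.inr (isHamiltonianList_boxProd hm hl)

theorem exists_twoWay_boxProd' {V W : Type*} {P : SimpleGraph V} {Q : SimpleGraph W}
    (hP : Traceable P) (hQ : ∃ y : ℤ → W, IsTwoWayHamiltonianPath Q y) :
    ∃ z : ℤ → V × W, IsTwoWayHamiltonianPath (P □ Q) z := by
  obtain ⟨z, hz⟩ := exists_twoWay_boxProd hQ hP
  exact ⟨_, hz.map_iso (boxProdComm Q P)⟩

theorem traceable_unit : Traceable (⊥ : SimpleGraph Unit) :=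
  Or.inr ⟨[()], by simp, by simp, by simp, by simp⟩

/-- The two-way infinite line. -/
def intLine : SimpleGraph ℤ where
  Adj i j := i = j + 1 ∨ j = i + 1
  symm := ⟨fun _ _ h => h.symm⟩
  loopless := ⟨fun i h => by omega⟩

theorem isTwoWay_intLine : IsTwoWayHamiltonianPath intLine id :=
  ⟨fun v => ⟨v, rfl, fun _ h => h⟩, fun _ => Or.inr rfl⟩

/-! ### Tilings of abelian groups -/

/-- A traceable system of exponents representing the integers modulo `n` (all integers if
`n = 0`) exactly once. -/
theorem exists_traceable_residues (n : ℕ) : ∃ (ι : Type) (P : SimpleGraph ι) (κ : ι → ℤ),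
    Traceable P ∧ (n = 0 → ∃ x : ℤ → ι, IsTwoWayHamiltonianPath P x) ∧
    (∀ i j, P.Adj i j → κ i = κ j + 1 ∨ κ j = κ i + 1) ∧ ∀ a : ℤ, ∃! i, (n : ℤ) ∣ a - κ i := by
  rcases Nat.eq_zero_or_pos n with rfl | hn
  · refine ⟨ℤ, intLine, id, Or.inl ⟨_, isTwoWay_intLine⟩, fun _ => ⟨_, isTwoWay_intLine⟩,
      fun i j h => h, fun a => ⟨a, by simp, fun b hb => ?_⟩⟩
    have : a - b = 0 := by simpa using hb
    exact (sub_eq_zero.1 this).symm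
  · refine ⟨Fin n, intLine.comap (fun i : Fin n => ((i : ℕ) : ℤ)), fun i => ((i : ℕ) : ℤ),
      Or.inr ⟨List.finRange n, ?_, List.nodup_finRange n, ?_, List.mem_finRange⟩,
      fun h => absurd h hn.ne', fun i j h => h, fun a => ?_⟩
    · intro h
      have := List.length_finRange (n := n)
      rw [h] at this
      simp at this
      omega
    · rw [List.isChain_iff_getElem]
      intro i hi
      exact Or.inr (by simp)
    · have hn' : (0 : ℤ) < n := by exact_mod_cast hn
      have h1 := Int.emod_nonneg a hn'.ne'
      have h2 := Int.emod_lt_of_pos a hn'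
      refine ⟨⟨(a % n).toNat, by omega⟩, ?_, ?_⟩
      · simp only [Int.toNat_of_nonneg h1]
        exact Int.dvd_self_sub_emod
      · intro b hb
        ext
        have hb' : ((b : ℕ) : ℤ) % n = a % n := (Int.modEq_iff_dvd).2 hb
        have := b.2
        rw [Int.emod_eq_of_lt (by omega) (by omega)] at hb'
        simp only
        omega

/-- The translates `τ i * X` form a partition of the subgroup `B`. -/
def Tiles {A : Type*} [CommGroup A] (B : Subgroup A) {ι : Type*} (τ : ι → A) (X : Set A) : Prop :=
  (∀ i, ∀ x ∈ X, τ i * x ∈ B) ∧ ∀ a ∈ B, ∃! i, (τ i)⁻¹ * a ∈ X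

theorem Tiles.prod {A : Type*} [CommGroup A] {B C : Subgroup A} {ι κ : Type*} {τ : ι → A}
    {q : κ → A} {X : Set A} (h : Tiles B τ X) (hq : Tiles C q (B : Set A)) :
    Tiles C (fun p : ι × κ => τ p.1 * q p.2) X := by
  refine ⟨fun p x hx => ?_, fun a ha => ?_⟩
  · have := hq.1 p.2 _ (h.1 p.1 x hx)
    rwa [mul_left_comm, ← mul_assoc] at this
  · obtain ⟨j, hj, hju⟩ := hq.2 a ha
    obtain ⟨i, hi, hiu⟩ := h.2 _ hj
    refine ⟨(i, j), by simpa [mul_assoc, mul_comm, mul_left_comm] using hi, ?_⟩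
    rintro ⟨i', j'⟩ h'
    simp only at h'
    have e : (τ i')⁻¹ * ((q j')⁻¹ * a) ∈ X := by
      simpa [mul_assoc, mul_comm, mul_left_comm] using h'
    have hj' : j' = j := by
      apply hju
      have := h.1 i' _ e
      rwa [mul_inv_cancel_left] at this
    subst hj'
    rw [hiu i' e]

theorem zpow_mem_iff_orderOf_dvd {A : Type*} [CommGroup A] (B : Subgroup A) (u : A) (k : ℤ) :
    u ^ k ∈ B ↔ (orderOf (u : A ⧸ B) : ℤ) ∣ k := by
  rw [orderOf_dvd_iff_zpow_eq_one, ← QuotientGroup.mk_zpow, QuotientGroup.eq_one_iff]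

theorem tiles_self {A : Type*} [CommGroup A] (B : Subgroup A) :
    Tiles B (fun _ : Unit => 1) (B : Set A) :=
  ⟨fun _ x hx => by simpa using hx, fun a ha => ⟨(), by simpa using ha, fun _ _ => rfl⟩⟩

/-- Adjoining `u`, of even or infinite order modulo `B`, to a tiled subgroup `B`: the enlarged
group is tiled by the doubled tile `X ∪ X * u`. The order is `2 * n`, with `n = 0` if it is
infinite, and the exponents `2 * e l` represent the even residues modulo this order. -/
theorem Tiles.domino {A : Type*} [CommGroup A] {B : Subgroup A} {ι κ : Type*} {τ : ι → A}
    {X : Set A} (h : Tiles B τ X) {u : A} {n : ℕ} (hn : orderOf (u : A ⧸ B) = 2 * n)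
    {e : κ → ℤ} (he : ∀ a : ℤ, ∃! l, (n : ℤ) ∣ a - e l) :
    Tiles (B ⊔ Subgroup.zpowers u) (fun p : ι × κ => τ p.1 * u ^ (2 * e p.2))
      (X ∪ (· * u) '' X) := by
  have hu : ∀ k : ℤ, u ^ k ∈ B ↔ (2 * n : ℤ) ∣ k := fun k => by
    rw [zpow_mem_iff_orderOf_dvd, hn]; push_cast; rfl
  refine ⟨fun p x hx => ?_, fun a ha => ?_⟩
  · rw [Subgroup.mem_sup]
    rcases hx with hx | ⟨x, hx, rfl⟩
    · exact ⟨_, h.1 p.1 x hx, u ^ (2 * e p.2), Subgroup.zpow_mem_zpowers _ _,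
        by simp [mul_assoc, mul_comm]⟩
    · exact ⟨_, h.1 p.1 x hx, u ^ (2 * e p.2 + 1), Subgroup.zpow_mem_zpowers _ _,
        by simp [zpow_add, mul_assoc, mul_comm, mul_left_comm]⟩
  · obtain ⟨b, hb, _, ⟨k, rfl⟩, rfl⟩ := Subgroup.mem_sup.1 ha
    simp only
    obtain ⟨l, ⟨c, hc⟩, hlu⟩ := he (k / 2)
    -- the parity of `k` decides in which half of the doubled tile the element lies
    have hcB : b * u ^ (k - 2 * e l - k % 2) ∈ B := by
      refine mul_mem hb ((hu _).2 ⟨c, ?_⟩)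
      rw [mul_assoc, ← hc]; omega
    obtain ⟨i, hi, hiu⟩ := h.2 _ hcB
    refine ⟨(i, l), ?_, ?_⟩
    · simp only
      rcases Int.emod_two_eq_zero_or_one k with hk | hk
      · left
        rw [hk] at hi
        have : (τ i * u ^ (2 * e l))⁻¹ * (b * u ^ k) = (τ i)⁻¹ * (b * u ^ (k - 2 * e l - 0)) := by
          rw [sub_zero, zpow_sub]
          simp [mul_assoc, mul_comm, mul_left_comm]
        rwa [this]
      · right
        rw [hk] at hi
        refine ⟨_, hi, ?_⟩
        have hk1 : u ^ (k - 2 * e l - 1) * u = u ^ (k - 2 * e l) := by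
          rw [← zpow_add_one, sub_add_cancel]
        simp only
        rw [mul_assoc, mul_assoc, hk1, zpow_sub]
        simp [mul_assoc, mul_comm, mul_left_comm]
    · rintro ⟨i', l'⟩ h'
      simp only at h'
      obtain ⟨δ, hδ, hX⟩ : ∃ δ : ℤ, (δ = 0 ∨ δ = 1) ∧
          (τ i')⁻¹ * (b * u ^ (k - 2 * e l' - δ)) ∈ X := by
        rcases h' with h' | ⟨x, hx, hxe⟩
        · refine ⟨0, Or.inl rfl, ?_⟩
          rw [sub_zero, zpow_sub]
          simpa [mul_assoc, mul_comm, mul_left_comm] using h'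
        · refine ⟨1, Or.inr rfl, ?_⟩
          have : x = (τ i')⁻¹ * (b * u ^ (k - 2 * e l' - 1)) := by
            rw [← mul_left_inj u]
            simp only at hxe
            have hk1 : u ^ (k - 2 * e l' - 1) * u = u ^ (k - 2 * e l') := by
              rw [← zpow_add_one, sub_add_cancel]
            rw [hxe, mul_assoc, mul_assoc, hk1, zpow_sub]
            simp [mul_assoc, mul_comm, mul_left_comm]
          rwa [← this]
      have hB := h.1 i' _ hX
      rw [mul_inv_cancel_left, Subgroup.mul_mem_cancel_left _ hb, hu] at hB
      obtain ⟨c', hc'⟩ := hB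
      have hc'' : k - 2 * e l' - δ = 2 * (n * c') := by rw [hc']; ring
      have hl : l' = l := hlu l' ⟨c', by omega⟩
      subst hl
      have hδk : δ = k % 2 := by omega
      subst hδk
      rw [hiu i' hX]

/-- Adjoining finitely many generators `U` to `B` yields coset representatives that are arranged
along a finite or two-way infinite path whose steps are generators. -/
theorem exists_traceable_transversal {A : Type*} [CommGroup A] (B : Subgroup A) {U : Set A}
    (hU : U.Finite) : ∃ (ι : Type) (P : SimpleGraph ι) (q : ι → A), Traceable P ∧
      (∀ i j, P.Adj i j → ∃ x, (x ∈ U ∨ x⁻¹ ∈ U) ∧ q j = q i * x) ∧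
      Tiles (B ⊔ Subgroup.closure U) q (B : Set A) := by
  induction U, hU using Set.Finite.induction_on with
  | empty =>
    refine ⟨Unit, ⊥, fun _ => 1, traceable_unit, fun i j h => absurd h (by simp), ?_⟩
    simpa using tiles_self B
  | @insert u U _ _ ih =>
    obtain ⟨ι, P, q, hP, hq, hT⟩ := ih
    obtain ⟨κ, Q, e, hQ, -, he, hr⟩ :=
      exists_traceable_residues (orderOf (u : A ⧸ (B ⊔ Subgroup.closure U)))
    have hT2 : Tiles ((B ⊔ Subgroup.closure U) ⊔ Subgroup.zpowers u) (fun l => u ^ e l)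
        ((B ⊔ Subgroup.closure U : Subgroup A) : Set A) := by
      refine ⟨fun l x hx => ?_, fun a ha => ?_⟩
      · exact mul_mem (Subgroup.mem_sup_right (Subgroup.zpow_mem_zpowers _ _))
          (Subgroup.mem_sup_left hx)
      · obtain ⟨b, hb, _, ⟨k, rfl⟩, rfl⟩ := Subgroup.mem_sup.1 ha
        have key : ∀ l, (u ^ e l)⁻¹ * (b * u ^ k) ∈ B ⊔ Subgroup.closure U ↔
            (orderOf (u : A ⧸ (B ⊔ Subgroup.closure U)) : ℤ) ∣ k - e l := by
          intro l
          rw [← zpow_mem_iff_orderOf_dvd, mul_left_comm, Subgroup.mul_mem_cancel_left _ hb,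
            zpow_sub, mul_comm]
        obtain ⟨l, hl, hlu⟩ := hr k
        exact ⟨l, (key l).2 hl, fun l' h' => hlu l' ((key l').1 h')⟩
    refine ⟨ι × κ, P □ Q, fun p => q p.1 * u ^ e p.2, hP.boxProd hQ, ?_, ?_⟩
    · rintro ⟨i, k⟩ ⟨j, l⟩ h
      rw [boxProd_adj] at h
      rcases h with ⟨h, hkl⟩ | ⟨h, hij⟩
      · simp only at h hkl
        subst hkl
        obtain ⟨x, hx, hx'⟩ := hq _ _ h
        refine ⟨x, hx.imp (Set.mem_insert_of_mem _) (Set.mem_insert_of_mem _), ?_⟩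
        simp [hx', mul_assoc, mul_comm]
      · simp only at h hij
        subst hij
        rcases he _ _ h with h | h
        · exact ⟨u⁻¹, Or.inr (by simp), by simp [h, zpow_add, mul_assoc]⟩
        · exact ⟨u, Or.inl (by simp), by simp [h, zpow_add, mul_assoc]⟩
    · have hC : B ⊔ Subgroup.closure (insert u U) =
          (B ⊔ Subgroup.closure U) ⊔ Subgroup.zpowers u := by
        rw [← Set.union_singleton, Subgroup.closure_union, Subgroup.zpowers_eq_closure, sup_assoc]
      rw [hC]
      exact hT.prod hT2

/-! ### Traversals of blocks -/

/-- The generators and their inverses. -/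
def letters {G : Type*} [Group G] (S : Set G) : Set G := {x | x ∈ S ∨ x⁻¹ ∈ S}

theorem inv_mem_letters {G : Type*} [Group G] {S : Set G} {x : G} :
    x⁻¹ ∈ letters S ↔ x ∈ letters S := by simp [letters, or_comm]

/-- `b` is reached from `a` by right multiplication with a generator or its inverse. -/
def CayStep {G : Type*} [Group G] (S : Set G) (a b : G) : Prop := a⁻¹ * b ∈ letters S

theorem CayStep.symm {G : Type*} [Group G] {S : Set G} {a b : G} (h : CayStep S a b) :
    CayStep S b a := by
  unfold CayStep at *
  rw [← inv_mem_letters]; simpa using h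

theorem CayStep.mul_left {G : Type*} [Group G] {S : Set G} {a b : G} (h : CayStep S a b) (c : G) :
    CayStep S (c * a) (c * b) := by
  unfold CayStep at *; simpa [mul_assoc] using h

theorem cayStep_mul {G : Type*} [Group G] {S : Set G} {a x : G} (h : x ∈ letters S) :
    CayStep S a (a * x) := by unfold CayStep; simpa using h

theorem CayStep.adj {G : Type*} [Group G] {S : Set G} {a b : G} (hab : a ≠ b)
    (h : CayStep S a b) : (mulCayley S).Adj a b := by
  rw [mulCayley_adj']
  refine ⟨hab, ?_⟩
  rcases h with h | h
  · exact ⟨_, h, Or.inl (by simp)⟩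
  · exact ⟨_, h, Or.inr (by simp)⟩

/-- `Trav S X e e'`: the preimage in `G` of the set `X ⊆ G/G'` has a hamiltonian path, in the
Cayley graph of `G`, that starts over `e` and ends over `e'`. -/
def Trav {G : Type*} [Group G] (S : Set G) (X : Set (Abelianization G)) (e e' : Abelianization G) :
    Prop :=
  ∃ l : List G, l.Nodup ∧ l.IsChain (CayStep S) ∧ (∀ g, g ∈ l ↔ Abelianization.of g ∈ X) ∧
    (∃ a ∈ l.head?, Abelianization.of a = e) ∧ ∃ b ∈ l.getLast?, Abelianization.of b = e'

theorem abelianization_of_surjective (G : Type*) [Group G] :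
    Function.Surjective (Abelianization.of : G →* Abelianization G) :=
  QuotientGroup.mk'_surjective _

section
variable {G : Type*} [Group G] {S : Set G} {X Y : Set (Abelianization G)}
  {e e' f f' : Abelianization G}

theorem Trav.symm (h : Trav S X e e') : Trav S X e' e := by
  obtain ⟨l, h1, h2, h3, h4, h5⟩ := h
  refine ⟨l.reverse, by simpa using h1, ?_, by simpa using h3, by simpa using h5, by simpa using h4⟩
  rw [List.isChain_reverse]
  exact h2.imp fun _ _ hab => hab.symm

theorem Trav.exists_map (h : Trav S X e e') (c : G) :
    ∃ l : List G, l.Nodup ∧ l.IsChain (CayStep S) ∧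
      (∀ g, g ∈ l ↔ (Abelianization.of c)⁻¹ * Abelianization.of g ∈ X) ∧
      (∃ a ∈ l.head?, ∃ a', a = c * a' ∧ Abelianization.of a' = e) ∧
      ∃ b ∈ l.getLast?, Abelianization.of b = Abelianization.of c * e' := by
  obtain ⟨l, h1, h2, h3, ⟨a, ha, ha'⟩, ⟨b, hb, hb'⟩⟩ := h
  refine ⟨l.map (c * ·), h1.map (mul_right_injective c), ?_, fun g => ?_,
    ⟨c * a, by simp_all, a, rfl, ha'⟩, ⟨c * b, by simp_all, by simp [hb']⟩⟩
  · exact List.isChain_map_of_isChain _ (fun a b hab => hab.mul_left c) h2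
  · rw [← map_inv, ← map_mul, ← h3, List.mem_map]
    constructor
    · rintro ⟨x, hx, rfl⟩; simpa using hx
    · exact fun hx => ⟨_, hx, by simp⟩

theorem Trav.translate (h : Trav S X e e') (c : Abelianization G)
    (hY : ∀ x, x ∈ Y ↔ c⁻¹ * x ∈ X) : Trav S Y (c * e) (c * e') := by
  obtain ⟨c, rfl⟩ := abelianization_of_surjective G c
  obtain ⟨l, h1, h2, h3, ⟨a, ha, a', rfl, ha'⟩, h5⟩ := h.exists_map c
  exact ⟨l, h1, h2, fun g => by rw [h3, hY], ⟨_, ha, by simp [ha']⟩, h5⟩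

theorem Trav.exists_from (h : Trav S X e e') {v : G} (hv : Abelianization.of v = e) :
    ∃ l : List G, l.Nodup ∧ l.IsChain (CayStep S) ∧ (∀ g, g ∈ l ↔ Abelianization.of g ∈ X) ∧
      l.head? = some v ∧ ∃ b ∈ l.getLast?, Abelianization.of b = e' := by
  obtain ⟨l, h1, h2, h3, ⟨a, ha, ha'⟩, ⟨b, hb, hb'⟩⟩ := h
  have hc : Abelianization.of (v * a⁻¹) = 1 := by rw [map_mul, map_inv, hv, ha', mul_inv_cancel]
  refine ⟨l.map (v * a⁻¹ * ·), h1.map (mul_right_injective _), ?_, fun g => ?_,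
    by simp_all, ⟨v * a⁻¹ * b, by simp_all, by rw [map_mul, hc, one_mul, hb']⟩⟩
  · exact List.isChain_map_of_isChain _ (fun a b hab => hab.mul_left _) h2
  · rw [List.mem_map]
    constructor
    · rintro ⟨x, hx, rfl⟩; rw [map_mul, hc, one_mul]; exact (h3 _).1 hx
    · exact fun hg => ⟨(v * a⁻¹)⁻¹ * g, (h3 _).2 (by rw [map_mul, map_inv, hc]; simpa using hg),
        mul_inv_cancel_left _ _⟩

theorem Trav.append (h : Trav S X e e') (h' : Trav S Y f f') (hd : Disjoint X Y) {x : G}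
    (hx : x ∈ letters S) (hf : f = e' * Abelianization.of x) : Trav S (X ∪ Y) e f' := by
  obtain ⟨l, h1, h2, h3, ⟨a, ha, ha'⟩, ⟨b, hb, hb'⟩⟩ := h
  obtain ⟨m, k1, k2, k3, k4, ⟨d, hd1, hd2⟩⟩ :=
    h'.exists_from (v := b * x) (by rw [map_mul, hb', hf])
  refine ⟨l ++ m, ?_, ?_, fun g => ?_, ⟨a, ?_, ha'⟩, ⟨d, ?_, hd2⟩⟩
  · rw [List.nodup_append']
    exact ⟨h1, k1, fun g hg hg' => Set.disjoint_left.1 hd ((h3 g).1 hg) ((k3 g).1 hg')⟩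
  · rw [List.isChain_append]
    refine ⟨h2, k2, fun p hp q hq => ?_⟩
    rw [hb, Option.mem_some_iff] at hp
    rw [k4, Option.mem_some_iff] at hq
    subst hp hq
    exact cayStep_mul hx
  · rw [List.mem_append, h3, k3]; rfl
  · rw [List.head?_append]; simp_all
  · rw [List.getLast?_append]; simp_all

/-- Running greedily through a sequence of blocks: from every entry port of a block one can
traverse it and step to an entry port of the next. -/
theorem exists_run (Z E : ℕ → Set (Abelianization G))
    (step : ∀ k, ∀ e ∈ E k, ∃ e', Trav S (Z k) e e' ∧
      ∃ x ∈ letters S, e' * Abelianization.of x ∈ E (k + 1))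
    (v₀ : G) (hv₀ : Abelianization.of v₀ ∈ E 0) :
    ∃ ℓ : ℕ → List G, (∀ k, ℓ k ≠ []) ∧ (∀ k, (ℓ k).IsChain (CayStep S)) ∧
      (∀ k, ∀ a ∈ (ℓ k).getLast?, ∀ b ∈ (ℓ (k + 1)).head?, CayStep S a b) ∧
      (∀ k, (ℓ k).Nodup) ∧ (∀ k g, g ∈ ℓ k ↔ Abelianization.of g ∈ Z k) ∧
      (ℓ 0).head? = some v₀ := by
  have step' : ∀ k (v : {v : G // Abelianization.of v ∈ E k}), ∃ l : List G, l.Nodup ∧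
      l.IsChain (CayStep S) ∧ (∀ g, g ∈ l ↔ Abelianization.of g ∈ Z k) ∧ l.head? = some v.1 ∧
      ∃ w : {w : G // Abelianization.of w ∈ E (k + 1)}, ∀ b ∈ l.getLast?, CayStep S b w.1 := by
    rintro k ⟨v, hv⟩
    obtain ⟨e', ht, x, hx, hx'⟩ := step k _ hv
    obtain ⟨l, h1, h2, h3, h4, b, hb, hb'⟩ := ht.exists_from (v := v) rfl
    refine ⟨l, h1, h2, h3, h4, ⟨b * x, by rw [map_mul, hb']; exact hx'⟩, fun b' hb'' => ?_⟩
    rw [hb, Option.mem_some_iff] at hb''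
    subst hb''
    exact cayStep_mul hx
  choose L h1 h2 h3 h4 w h5 using step'
  let v : ∀ k, {v : G // Abelianization.of v ∈ E k} := fun k =>
    Nat.rec (motive := fun k => {v : G // Abelianization.of v ∈ E k}) ⟨v₀, hv₀⟩ (fun k v => w k v) k
  refine ⟨fun k => L k (v k), fun k hk => ?_, fun k => h2 _ _, fun k a ha b hb => ?_,
    fun k => h1 _ _, fun k g => h3 _ _ _, h4 _ _⟩
  · have := h4 k (v k)
    simp only at hk
    rw [hk] at this
    simp at this
  · simp only [h4, Option.mem_some_iff] at hb
    subst hb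
    exact h5 k (v k) a ha

/-- A two-way infinite sequence of congruent blocks that can be traversed in both directions
yields a two-way hamiltonian path. The ports `Ep` are used while moving forwards, the ports `Em`
while moving backwards. -/
theorem exists_twoWay_of_int_tiles {τ : ℤ → Abelianization G} {Ep Em : Set (Abelianization G)}
    (hT : Tiles ⊤ τ X)
    (fwd : ∀ i, ∀ e ∈ Ep, ∃ e', Trav S X e e' ∧ ∃ x ∈ letters S,
      (τ (i + 1))⁻¹ * (τ i * e' * Abelianization.of x) ∈ Ep)
    (bwd : ∀ i, ∀ e ∈ Em, ∃ e', Trav S X e e' ∧ ∃ x ∈ letters S,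
      (τ i)⁻¹ * (τ (i + 1) * e' * Abelianization.of x) ∈ Em)
    (start : ∃ f ∈ Em, ∃ x ∈ letters S, (τ 0)⁻¹ * (τ (-1) * f * Abelianization.of x) ∈ Ep) :
    ∃ x : ℤ → G, IsTwoWayHamiltonianPath (mulCayley S) x := by
  obtain ⟨f, hf, x, hx, hfx⟩ := start
  obtain ⟨u, hu⟩ := abelianization_of_surjective G (τ (-1) * f)
  have tr : ∀ i, ∀ e e', Trav S X e e' → Trav S {a | (τ i)⁻¹ * a ∈ X} (τ i * e) (τ i * e') :=
    fun i e e' h => h.translate (τ i) fun _ => Iff.rfl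
  obtain ⟨ℓ, a1, a2, a3, a4, a5, a6⟩ := exists_run (S := S)
    (fun k : ℕ => {a | (τ k)⁻¹ * a ∈ X}) (fun k : ℕ => {a | (τ k)⁻¹ * a ∈ Ep})
    (by
      intro k e he
      obtain ⟨e', ht, x, hx, hxe⟩ := fwd k _ he
      refine ⟨τ k * e', ?_, x, hx, by simpa using hxe⟩
      simpa using tr k _ _ ht) (u * x) (by
        rw [map_mul, hu]
        simpa using hfx)
  obtain ⟨ℓ', b1, b2, b3, b4, b5, b6⟩ := exists_run (S := S)
    (fun k : ℕ => {a | (τ (-1 - k))⁻¹ * a ∈ X}) (fun k : ℕ => {a | (τ (-1 - k))⁻¹ * a ∈ Em})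
    (by
      intro k e he
      have hk : (-1 - (k : ℤ)) = (-1 - ((k + 1 : ℕ) : ℤ)) + 1 := by push_cast; ring
      rw [Set.mem_ofPred_eq, hk] at he
      obtain ⟨e', ht, x, hx, hxe⟩ := bwd (-1 - ((k + 1 : ℕ) : ℤ)) _ he
      rw [← hk] at ht hxe
      exact ⟨τ (-1 - k) * e', by simpa using tr (-1 - k) _ _ ht, x, hx, hxe⟩) u (by
        rw [hu]; simpa using hf)
  refine exists_twoWay_of_lists (R := CayStep S) (fun a b hab h => h.adj hab) ℓ ℓ' a1 a2 a3 a4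
    ?_ b1 b2 b3 b4 ?_ ?_ ?_ ?_
  · intro j k v hj hk
    have := (hT.2 (Abelianization.of v) trivial).unique ((a5 j v).1 hj) ((a5 k v).1 hk)
    exact_mod_cast this
  · intro j k v hj hk
    have := (hT.2 (Abelianization.of v) trivial).unique ((b5 j v).1 hj) ((b5 k v).1 hk)
    omega
  · intro j k v hj hk
    have := (hT.2 (Abelianization.of v) trivial).unique ((a5 j v).1 hj) ((b5 k v).1 hk)
    omega
  · intro v
    obtain ⟨i, hi, -⟩ := hT.2 (Abelianization.of v) trivial
    rcases le_or_gt 0 i with h | h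
    · lift i to ℕ using h
      exact Or.inl ⟨i, (a5 i v).2 hi⟩
    · obtain ⟨k, rfl⟩ : ∃ k : ℕ, i = -1 - k := ⟨(-1 - i).toNat, by omega⟩
      exact Or.inr ⟨k, (b5 k v).2 hi⟩
  · intro a ha b hb
    rw [a6, Option.mem_some_iff] at ha
    rw [b6, Option.mem_some_iff] at hb
    subst ha hb
    exact (cayStep_mul hx).symm

/-- Congruent blocks indexed by a graph with a two-way hamiltonian path, such that from every port
of a block one can traverse it and step to a port of any prescribed neighbouring block. -/
theorem exists_twoWay_of_tiles {I : Type*} {Γ : SimpleGraph I}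
    (hΓ : ∃ z : ℤ → I, IsTwoWayHamiltonianPath Γ z) {τ : I → Abelianization G}
    {E : Set (Abelianization G)} (hT : Tiles ⊤ τ X) (hE : E.Nonempty)
    (link : ∀ i j, Γ.Adj i j → ∀ e ∈ E, ∃ e' ∈ E, Trav S X e e' ∧ ∃ x ∈ letters S,
      (τ j)⁻¹ * (τ i * e' * Abelianization.of x) ∈ E) :
    ∃ x : ℤ → G, IsTwoWayHamiltonianPath (mulCayley S) x := by
  obtain ⟨z, hz⟩ := hΓ
  refine exists_twoWay_of_int_tiles (τ := τ ∘ z) (X := X) (Ep := E) (Em := E) ?_ ?_ ?_ ?_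
  · refine ⟨fun i x hx => trivial, fun a ha => ?_⟩
    obtain ⟨i, hi, hiu⟩ := hT.2 a ha
    obtain ⟨k, rfl⟩ := hz.surjective i
    exact ⟨k, hi, fun k' hk' => hz.injective (hiu _ hk')⟩
  · intro i e he
    obtain ⟨e', -, h1, h2⟩ := link _ _ (hz.2 i) e he
    exact ⟨e', h1, h2⟩
  · intro i e he
    obtain ⟨e', -, h1, h2⟩ := link _ _ (hz.2 i).symm e he
    exact ⟨e', h1, h2⟩
  · obtain ⟨e, he⟩ := hE
    obtain ⟨e', he', -, h2⟩ := link _ _ (hz.2 (-1)) e he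
    exact ⟨e', he', h2⟩

end

/-! ### Lifting cycles from the abelianization -/

/-- The vertices passed by the walk that starts at `g` and reads the word `w`, the final vertex
excluded. -/
def openTrace {M : Type*} [Mul M] : M → List M → List M
  | _, [] => []
  | g, x :: w => g :: openTrace (g * x) w

theorem openTrace_append {M : Type*} [Monoid M] (g : M) (v w : List M) :
    openTrace g (v ++ w) = openTrace g v ++ openTrace (g * v.prod) w := by
  induction v generalizing g with
  | nil => simp [openTrace]
  | cons x v ih => simp [openTrace, ih, mul_assoc]

theorem length_openTrace {M : Type*} [Mul M] (g : M) (w : List M) :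
    (openTrace g w).length = w.length := by
  induction w generalizing g with
  | nil => rfl
  | cons x w ih => simp [openTrace, ih]

theorem map_openTrace {M N : Type*} [Monoid M] [Monoid N] (f : M →* N) (g : M) (w : List M) :
    (openTrace g w).map f = openTrace (f g) (w.map f) := by
  induction w generalizing g with
  | nil => rfl
  | cons x w ih => simp [openTrace, ih]

theorem openTrace_mul {M : Type*} [Monoid M] (c g : M) (w : List M) :
    openTrace (c * g) w = (openTrace g w).map (c * ·) := by
  induction w generalizing g with
  | nil => rfl
  | cons x w ih => simp [openTrace, ← ih, mul_assoc]

theorem isChain_openTrace {G : Type*} [Group G] {S : Set G} (g : G) {w : List G}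
    (hw : ∀ x ∈ w, x ∈ letters S) : (openTrace g w).IsChain (CayStep S) := by
  induction w generalizing g with
  | nil => simp [openTrace]
  | cons x w ih =>
    simp only [List.forall_mem_cons] at hw
    refine (ih (g * x) hw.2).cons fun y hy => ?_
    cases w with
    | nil => simp [openTrace] at hy
    | cons z w =>
      simp only [openTrace, List.head?_cons, Option.mem_some_iff] at hy
      subst hy
      exact cayStep_mul hw.1

theorem mem_openTrace_flatten_replicate {M : Type*} [Monoid M] (g h : M) (w : List M) (n : ℕ) :
    h ∈ openTrace g (List.replicate n w).flatten ↔ ∃ k < n, h ∈ openTrace (g * w.prod ^ k) w := by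
  induction n with
  | zero => simp [openTrace]
  | succ n ih =>
    rw [List.replicate_succ', List.flatten_append, openTrace_append, List.mem_append, ih]
    simp only [List.prod_flatten, List.map_replicate, List.prod_replicate, List.flatten_cons,
      List.flatten_nil, List.append_nil]
    constructor
    · rintro (⟨k, hk, h⟩ | h)
      · exact ⟨k, by omega, h⟩
      · exact ⟨n, by omega, h⟩
    · rintro ⟨k, hk, h⟩
      rcases Nat.lt_succ_iff_lt_or_eq.1 hk with hk | rfl
      · exact Or.inl ⟨k, hk, h⟩
      · exact Or.inr h

/-- A list that is no longer than a set it exhausts lists that set without repetition. -/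
theorem nodup_and_mem_iff_of_length_le_ncard {α : Type*} {l : List α} {X : Set α}
    (hX : ∀ a ∈ X, a ∈ l) (hl : l.length ≤ X.ncard) : l.Nodup ∧ ∀ a, a ∈ l ↔ a ∈ X := by
  classical
  have hfin : ((l.toFinset : Finset α) : Set α).Finite := Finset.finite_toSet _
  have hsub : X ⊆ ((l.toFinset : Finset α) : Set α) := fun a ha => by simpa using hX a ha
  have h1 : ((l.toFinset : Finset α) : Set α).ncard ≤ l.length := by
    rw [Set.ncard_coe_finset]; exact l.toFinset_card_le
  have h2 := Set.eq_of_subset_of_ncard_le hsub (h1.trans hl) hfin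
  refine ⟨?_, fun a => by rw [h2]; simp⟩
  have h3 : l.toFinset.card = l.length := by
    rw [h2, Set.ncard_coe_finset] at hl
    exact le_antisymm l.toFinset_card_le hl
  exact Multiset.toFinset_card_eq_card_iff_nodup.1 h3

/-- The word `W` describes a closed walk in the abelianization that starts at `e` and runs once
through every vertex of `X`, but whose lifts to `G` are not closed. -/
structure IsTwistedCycle {G : Type*} [Group G] (S : Set G) (X : Set (Abelianization G))
    (e : Abelianization G) (W : List G) : Prop where
  mem_letters : ∀ x ∈ W, x ∈ letters S
  nodup : (openTrace e (W.map Abelianization.of)).Nodup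
  mem_iff : ∀ a, a ∈ openTrace e (W.map Abelianization.of) ↔ a ∈ X
  closed : Abelianization.of W.prod = 1
  twisted : W.prod ≠ 1

theorem isTwistedCycle_of_ncard {G : Type*} [Group G] {S : Set G} {X : Set (Abelianization G)}
    {e : Abelianization G} {W : List G} (h1 : ∀ x ∈ W, x ∈ letters S)
    (h2 : ∀ a ∈ X, a ∈ openTrace e (W.map Abelianization.of)) (h3 : W.length ≤ X.ncard)
    (h4 : Abelianization.of W.prod = 1) (h5 : W.prod ≠ 1) : IsTwistedCycle S X e W := by
  obtain ⟨h6, h7⟩ := nodup_and_mem_iff_of_length_le_ncard h2 (by simpa [length_openTrace] using h3)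
  exact ⟨h1, h6, h7, h4, h5⟩

theorem abelianization_of_eq_one_iff {G : Type*} [Group G] {g : G} :
    Abelianization.of g = 1 ↔ g ∈ commutator G := by
  rw [← MonoidHom.mem_ker, Abelianization.ker_of]

theorem IsTwistedCycle.rotate {G : Type*} [Group G] {S : Set G} {X : Set (Abelianization G)}
    {e : Abelianization G} {V W : List G} (h : IsTwistedCycle S X e (V ++ W)) :
    IsTwistedCycle S X (e * Abelianization.of V.prod) (W ++ V) := by
  have hVW : Abelianization.of V.prod * Abelianization.of W.prod = 1 := by
    rw [← map_mul, ← List.prod_append]; exact h.closed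
  have hperm : (openTrace (e * Abelianization.of V.prod) ((W ++ V).map Abelianization.of)).Perm
      (openTrace e ((V ++ W).map Abelianization.of)) := by
    rw [List.map_append, List.map_append, openTrace_append, openTrace_append,
      ← map_list_prod, ← map_list_prod, mul_assoc, hVW, mul_one]
    exact List.perm_append_comm
  refine ⟨fun x hx => h.mem_letters x ?_, hperm.nodup_iff.2 h.nodup, fun a => ?_, ?_, fun h' => ?_⟩
  · rw [List.mem_append] at *; exact hx.symm
  · rw [hperm.mem_iff, h.mem_iff]
  · rw [List.prod_append, map_mul, mul_comm]; exact hVW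
  · apply h.twisted
    rw [List.prod_append] at *
    rw [mul_eq_one_iff_eq_inv] at *
    rw [h', inv_inv]

/-- Since `G'` has prime order, the `p`-fold repetition of a twisted cycle lifts to a hamiltonian
cycle of the preimage of `X`. -/
theorem IsTwistedCycle.exists_hamiltonian_cycle {G : Type*} [Group G] {S : Set G} {p : ℕ}
    (hp : p.Prime) (hc : Nat.card (commutator G) = p) {X : Set (Abelianization G)}
    {e : Abelianization G} {V : List G} {x : G} (h : IsTwistedCycle S X e (V ++ [x])) :
    ∃ l : List G, l.Nodup ∧ l.IsChain (CayStep S) ∧ (∀ g, g ∈ l ↔ Abelianization.of g ∈ X) ∧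
      ∃ a ∈ l.head?, ∃ b ∈ l.getLast?, Abelianization.of a = e ∧
        Abelianization.of b = e * (Abelianization.of x)⁻¹ ∧ CayStep S b a := by
  have : Fact p.Prime := ⟨hp⟩
  set W := V ++ [x] with hW
  obtain ⟨g, rfl⟩ := abelianization_of_surjective G e
  -- moving once around the cycle multiplies lifts from the left by `d`, which generates `G'`
  set d : G := g * W.prod * g⁻¹ with hd
  have hdpow : ∀ k : ℕ, g * W.prod ^ k = d ^ k * g := by
    intro k; rw [hd, conj_pow]; group
  have hd1 : Abelianization.of d = 1 := by
    rw [hd, map_mul, map_mul, h.closed, mul_one, map_inv, mul_inv_cancel]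
  have hdne : d ≠ 1 := by
    rw [hd]; intro h'; exact h.twisted (by simpa using conj_eq_one_iff.1 h')
  have hdN : d ∈ commutator G := abelianization_of_eq_one_iff.1 hd1
  have hord : orderOf d = p := by
    refine orderOf_eq_prime ?_ hdne
    have := pow_card_eq_one' (x := (⟨d, hdN⟩ : commutator G))
    rw [hc] at this
    simpa using congrArg Subtype.val this
  have hgen : ∀ n ∈ commutator G, ∃ k < p, d ^ k = n := by
    intro n hn
    have hz : Subgroup.zpowers (⟨d, hdN⟩ : commutator G) = ⊤ :=
      zpowers_eq_top_of_prime_card hc (by simpa [Subtype.ext_iff] using hdne)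
    have h1 : (⟨n, hn⟩ : commutator G) ∈ Subgroup.zpowers (⟨d, hdN⟩ : commutator G) := by
      rw [hz]; trivial
    obtain ⟨k, hk⟩ := h1
    have hk' : d ^ k = n := by simpa using congrArg Subtype.val hk
    refine ⟨(k % p).toNat, ?_, ?_⟩
    · have := Int.emod_lt_of_pos k (by exact_mod_cast hp.pos : (0 : ℤ) < p)
      have := Int.emod_nonneg k (by exact_mod_cast hp.ne_zero : (p : ℤ) ≠ 0)
      omega
    · rw [← zpow_natCast, Int.toNat_of_nonneg
        (Int.emod_nonneg k (by exact_mod_cast hp.ne_zero : (p : ℤ) ≠ 0)), ← hord,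
        zpow_mod_orderOf, hk']
  have hmem : ∀ y, y ∈ openTrace g (List.replicate p W).flatten ↔
      ∃ k < p, ∃ a ∈ openTrace g W, d ^ k * a = y := by
    intro y
    rw [mem_openTrace_flatten_replicate]
    simp only [hdpow, openTrace_mul, List.mem_map]
  have hπ : ∀ a ∈ openTrace g W, ∀ b ∈ openTrace g W,
      Abelianization.of a = Abelianization.of b → a = b := by
    have := h.nodup
    rw [← map_openTrace] at this
    exact fun a ha b hb hab => List.inj_on_of_nodup_map this ha hb hab
  have hX : ∀ a, a ∈ X ↔ ∃ b ∈ openTrace g W, Abelianization.of b = a := by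
    intro a
    rw [← h.mem_iff, ← map_openTrace, List.mem_map]
  have hπd : ∀ (k : ℕ) a, Abelianization.of (d ^ k * a) = Abelianization.of a := by
    intro k a; rw [map_mul, map_pow, hd1, one_pow, one_mul]
  obtain ⟨q, hq⟩ : ∃ q, p = q + 1 := ⟨p - 1, by have := hp.pos; omega⟩
  refine ⟨openTrace g (List.replicate p W).flatten, ?_, ?_, ?_, g, ?_,
    g * W.prod ^ q * V.prod, ?_, rfl, ?_, ?_⟩
  · have aux : ∀ n ≤ p, (openTrace g (List.replicate n W).flatten).Nodup := by
      intro n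
      induction n with
      | zero => simp [openTrace]
      | succ n ih =>
        intro hn
        rw [List.replicate_succ', List.flatten_append, openTrace_append, List.nodup_append']
        simp only [List.prod_flatten, List.map_replicate, List.prod_replicate, List.flatten_cons,
          List.flatten_nil, List.append_nil]
        rw [hdpow, openTrace_mul]
        refine ⟨ih (by omega), ?_, ?_⟩
        · have := h.nodup
          rw [← map_openTrace] at this
          exact (List.Nodup.of_map _ this).map (mul_right_injective _)
        · intro y hy hy'
          rw [mem_openTrace_flatten_replicate] at hy
          obtain ⟨k, hk, hy⟩ := hy
          rw [hdpow, openTrace_mul] at hy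
          obtain ⟨a, ha, rfl⟩ := List.mem_map.1 hy
          obtain ⟨b, hb, hab⟩ := List.mem_map.1 hy'
          have e1 : a = b := hπ a ha b hb (by rw [← hπd k a, ← hab, hπd])
          subst e1
          have e2 : d ^ n = d ^ k := mul_right_cancel hab
          have := pow_injOn_Iio_orderOf (x := d) (x₁ := n) (by simp [hord]; omega)
            (x₂ := k) (by simp [hord]; omega) e2
          omega
    exact aux p le_rfl
  · refine isChain_openTrace g fun y hy => ?_
    simp only [List.mem_flatten, List.mem_replicate] at hy
    obtain ⟨l, ⟨-, rfl⟩, hy⟩ := hy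
    exact h.mem_letters y hy
  · intro y
    rw [hmem, hX]
    constructor
    · rintro ⟨k, -, a, ha, rfl⟩
      exact ⟨a, ha, (hπd k a).symm⟩
    · rintro ⟨b, hb, hby⟩
      have : y * b⁻¹ ∈ commutator G := by
        rw [← abelianization_of_eq_one_iff, map_mul, map_inv, hby, mul_inv_cancel]
      obtain ⟨k, hk, hk'⟩ := hgen _ this
      exact ⟨k, hk, b, hb, by rw [hk']; group⟩
  · rw [hq, List.replicate_succ, List.flatten_cons, hW]
    cases V <;> simp [openTrace]
  · rw [hq, List.replicate_succ', List.flatten_append, openTrace_append]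
    simp only [List.prod_flatten, List.map_replicate, List.prod_replicate, List.flatten_cons,
      List.flatten_nil, List.append_nil]
    rw [hW, openTrace_append, ← hW]
    simp [openTrace]
  · have hcl := h.closed
    rw [hW, List.prod_append, map_mul, List.prod_singleton, mul_eq_one_iff_eq_inv] at hcl
    rw [map_mul, map_mul, map_pow, h.closed, hcl]
    simp
  · have hend : g * W.prod ^ q * V.prod * x = g := by
      rw [mul_assoc _ V.prod, ← List.prod_singleton (x := x), ← List.prod_append, ← hW, mul_assoc,
        ← pow_succ, ← hq, hdpow, ← hord, pow_orderOf_eq_one, one_mul]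
    have := cayStep_mul (a := g * W.prod ^ q * V.prod) (h.mem_letters x (by simp [hW]))
    rwa [hend] at this

theorem IsTwistedCycle.trav_append_singleton {G : Type*} [Group G] {S : Set G} {p : ℕ}
    (hp : p.Prime) (hc : Nat.card (commutator G) = p) {X : Set (Abelianization G)}
    {e : Abelianization G} {V : List G} {x : G} (h : IsTwistedCycle S X e (V ++ [x])) :
    Trav S X e (e * (Abelianization.of x)⁻¹) := by
  obtain ⟨l, h1, h2, h3, a, ha, b, hb, ha', hb', -⟩ := h.exists_hamiltonian_cycle hp hc
  exact ⟨l, h1, h2, h3, ⟨a, ha, ha'⟩, b, hb, hb'⟩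

theorem IsTwistedCycle.trav {G : Type*} [Group G] {S : Set G} {p : ℕ}
    (hp : p.Prime) (hc : Nat.card (commutator G) = p) {X : Set (Abelianization G)}
    {e : Abelianization G} {V W : List G} {x : G} (h : IsTwistedCycle S X e (V ++ x :: W))
    {f f' : Abelianization G} (hf : f = e * Abelianization.of V.prod)
    (hf' : f' = f * Abelianization.of x) : Trav S X f f' := by
  have h1 : IsTwistedCycle S X f' (W ++ (V ++ [x])) := by
    have : V ++ x :: W = (V ++ [x]) ++ W := by simp
    rw [this] at h
    have := h.rotate
    rwa [List.prod_append, List.prod_singleton, map_mul, ← mul_assoc, ← hf, ← hf'] at this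
  rw [← List.append_assoc] at h1
  have := (h1.trav_append_singleton hp hc).symm
  rw [hf', mul_inv_cancel_right] at this
  rw [hf']; exact this

/-! ### Blocks over finite subgroups -/

section
variable {G : Type*} [Group G] {S : Set G}

theorem subset_letters {x : G} (hx : x ∈ S) : x ∈ letters S := Or.inl hx

theorem Tiles.finite {A : Type*} [CommGroup A] {B : Subgroup A} {ι : Type*} [Finite ι] {τ : ι → A}
    {X : Set A} (h : Tiles B τ X) (hX : X.Finite) : (B : Set A).Finite := by
  refine (Set.finite_iUnion fun i => hX.image (τ i * ·)).subset fun a ha => ?_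
  obtain ⟨i, hi, -⟩ := h.2 a ha
  exact Set.mem_iUnion.2 ⟨i, _, hi, mul_inv_cancel_left _ _⟩

theorem closure_image_abelianization (hgen : Subgroup.closure S = ⊤) :
    Subgroup.closure (Abelianization.of '' S) = ⊤ := by
  rw [← MonoidHom.map_closure, hgen, ← MonoidHom.range_eq_map,
    MonoidHom.range_eq_top.2 (abelianization_of_surjective G)]

/-- Coset representatives of `B`, arranged along a finite or two-way infinite path whose steps are
images of letters. -/
theorem exists_transversal (hfin : S.Finite) (hgen : Subgroup.closure S = ⊤)
    (B : Subgroup (Abelianization G)) :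
    ∃ (ι : Type) (P : SimpleGraph ι) (q : ι → Abelianization G), Traceable P ∧
      (∀ i j, P.Adj i j → ∃ x ∈ letters S, q j = q i * Abelianization.of x) ∧
      Tiles ⊤ q (B : Set (Abelianization G)) := by
  obtain ⟨ι, P, q, h1, h2, h3⟩ := exists_traceable_transversal B (hfin.image Abelianization.of)
  refine ⟨ι, P, q, h1, fun i j hij => ?_, ?_⟩
  · obtain ⟨x, hx, e⟩ := h2 i j hij
    rcases hx with ⟨y, hy, rfl⟩ | ⟨y, hy, hyx⟩
    · exact ⟨y, Or.inl hy, e⟩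
    · exact ⟨y⁻¹, Or.inr (by simpa using hy), by rw [map_inv, hyx, inv_inv]; exact e⟩
  · rwa [closure_image_abelianization hgen, sup_top_eq] at h3

theorem IsHamiltonianList.finite {V : Type*} {P : SimpleGraph V} {l : List V}
    (h : IsHamiltonianList P l) : Finite V := by
  refine Set.finite_univ_iff.1 ((List.finite_toSet l).subset fun v _ => h.2.2.2 v)

/-- A twisted cycle through a finite subgroup `F` of `G/G'` gives a two-way hamiltonian path: the
preimage of `F` can be entered at any vertex. -/
theorem exists_twoWay_of_finite_subgroup [Infinite (Abelianization G)] (hfin : S.Finite)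
    (hgen : Subgroup.closure S = ⊤) {p : ℕ} (hp : p.Prime) (hc : Nat.card (commutator G) = p)
    {F : Subgroup (Abelianization G)} (hF : (F : Set (Abelianization G)).Finite) {W : List G}
    (h : IsTwistedCycle S (F : Set (Abelianization G)) 1 W) :
    ∃ x : ℤ → G, IsTwoWayHamiltonianPath (mulCayley S) x := by
  obtain ⟨ι, P, q, hP, hq, hT⟩ := exists_transversal hfin hgen F
  have hP' : ∃ z : ℤ → ι, IsTwoWayHamiltonianPath P z := by
    refine hP.resolve_right ?_
    rintro ⟨l, hl⟩
    have := hl.finite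
    have := hT.finite hF
    rw [Subgroup.coe_top, Set.finite_univ_iff] at this
    exact not_finite (Abelianization G)
  obtain ⟨x, W', rfl⟩ : ∃ x W', W = x :: W' := by
    cases W with
    | nil => exact absurd rfl h.twisted
    | cons x W' => exact ⟨x, W', rfl⟩
  have ht : Trav S (F : Set (Abelianization G)) 1 (Abelianization.of x) :=
    IsTwistedCycle.trav hp hc (V := []) h (by simp) (by simp)
  have hx : Abelianization.of x ∈ F := by
    obtain ⟨l, -, -, h3, -, b, hb, hb'⟩ := ht
    rw [← hb']; exact (h3 b).1 (List.mem_of_getLast? hb)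
  refine exists_twoWay_of_tiles hP' hT (E := (F : Set (Abelianization G))) ⟨1, one_mem F⟩ ?_
  intro i j hij e he
  obtain ⟨y, hy, hy'⟩ := hq i j hij
  refine ⟨e * Abelianization.of x, mul_mem he hx, ?_, y, hy, ?_⟩
  · simpa using ht.translate (Y := (F : Set (Abelianization G))) e fun a => by
      simp only [SetLike.mem_coe]; rw [Subgroup.mul_mem_cancel_left _ (inv_mem he)]
  · have : (q j)⁻¹ * (q i * (e * Abelianization.of x) * Abelianization.of y) =
        e * Abelianization.of x := by
      rw [hy', mul_right_comm, inv_mul_cancel_left]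
    rw [this]; exact mul_mem he hx

/-- Let `z` be a generator of infinite order modulo `G'` and `F` a finite subgroup of `G/G'`. If
the preimage of `F ∪ F * z` can be traversed along three consecutive edges of a path that go
inside `F`, across, and inside `F * z`, there is a two-way hamiltonian path. -/
theorem exists_twoWay_of_finite_subgroup_union [Infinite (Abelianization G)] (hfin : S.Finite)
    (hgen : Subgroup.closure S = ⊤) {F : Subgroup (Abelianization G)}
    (hF : (F : Set (Abelianization G)).Finite) {z : G} (hz : z ∈ letters S)
    (hzo : orderOf (Abelianization.of z) = 0) {a b c d : Abelianization G}
    (ha : a ∈ F) (hb : b ∈ F) (hcz : c * (Abelianization.of z)⁻¹ ∈ F)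
    (hdz : d * (Abelianization.of z)⁻¹ ∈ F)
    (hab : Trav S ((F : Set (Abelianization G)) ∪ (· * Abelianization.of z) '' F) a b)
    (hbc : Trav S ((F : Set (Abelianization G)) ∪ (· * Abelianization.of z) '' F) b c)
    (hcd : Trav S ((F : Set (Abelianization G)) ∪ (· * Abelianization.of z) '' F) c d) :
    ∃ x : ℤ → G, IsTwoWayHamiltonianPath (mulCayley S) x := by
  set ζ := Abelianization.of z with hζ
  set X : Set (Abelianization G) := (F : Set (Abelianization G)) ∪ (· * ζ) '' F with hX
  have hXz : ∀ e, e ∈ X ↔ e ∈ F ∨ e * ζ⁻¹ ∈ F := by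
    intro e
    rw [hX, Set.mem_union, Set.mem_image]
    refine or_congr Iff.rfl ⟨?_, fun h => ⟨_, h, by simp⟩⟩
    rintro ⟨f, hf, rfl⟩; simpa using hf
  obtain ⟨κ, Q, ex, hQ, hQz, hex, hres⟩ := exists_traceable_residues 0
  have ho : orderOf (ζ : Abelianization G ⧸ F) = 2 * 0 := by
    rw [mul_zero, orderOf_eq_zero_iff']
    intro n hn h
    rw [← QuotientGroup.mk_pow, QuotientGroup.eq_one_iff] at h
    have hfo : IsOfFinOrder (ζ ^ n) := by
      have : Finite F := hF.to_subtype
      simpa using MonoidHom.isOfFinOrder F.subtype (isOfFinOrder_of_finite (⟨_, h⟩ : F))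
    rw [isOfFinOrder_pow] at hfo
    rcases hfo with hfo | hfo
    · exact orderOf_eq_zero_iff.1 hzo hfo
    · omega
  obtain ⟨ι, P, q, hP, hq, hT⟩ := exists_transversal hfin hgen (F ⊔ Subgroup.zpowers ζ)
  have htile := ((tiles_self F).domino ho hres).prod hT
  have hΓ := exists_twoWay_boxProd
    (exists_twoWay_boxProd' traceable_unit (hQz rfl)) hP
  have htr : ∀ f ∈ F, ∀ {u v}, Trav S X u v → Trav S X (f * u) (f * v) := by
    intro f hf u v h
    refine h.translate f fun x => ?_
    rw [hXz, hXz, mul_assoc, Subgroup.mul_mem_cancel_left _ (inv_mem hf),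
      Subgroup.mul_mem_cancel_left _ (inv_mem hf)]
  have toF : ∀ e ∈ X, ∃ e' ∈ F, Trav S X e e' := by
    intro e he
    rcases (hXz e).1 he with he | he
    · exact ⟨e * b⁻¹ * a, mul_mem (mul_mem he (inv_mem hb)) ha, by
        simpa using htr (e * b⁻¹) (mul_mem he (inv_mem hb)) hab.symm⟩
    · have hec : e * c⁻¹ ∈ F := by
        simpa [mul_assoc, mul_comm, mul_left_comm] using mul_mem he (inv_mem hcz)
      exact ⟨e * c⁻¹ * b, mul_mem hec hb, by simpa using htr _ hec hbc.symm⟩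
  have toFz : ∀ e ∈ X, ∃ e', e' * ζ⁻¹ ∈ F ∧ Trav S X e e' := by
    intro e he
    rcases (hXz e).1 he with he | he
    · exact ⟨e * b⁻¹ * c, by
        rw [mul_assoc]; exact mul_mem (mul_mem he (inv_mem hb)) hcz, by
        simpa using htr (e * b⁻¹) (mul_mem he (inv_mem hb)) hbc⟩
    · have hec : e * c⁻¹ ∈ F := by
        simpa [mul_assoc, mul_comm, mul_left_comm] using mul_mem he (inv_mem hcz)
      exact ⟨e * c⁻¹ * d, by rw [mul_assoc]; exact mul_mem hec hdz, by
        simpa using htr _ hec hcd⟩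
  refine exists_twoWay_of_tiles hΓ htile (E := X) ⟨1, (hXz 1).2 (Or.inl (one_mem F))⟩ ?_
  rintro ⟨⟨u, k⟩, i⟩ ⟨⟨u', l⟩, j⟩ hadj e he
  rw [boxProd_adj, boxProd_adj] at hadj
  rcases hadj with ⟨⟨h, -⟩ | ⟨h, -⟩, h'⟩ | ⟨h, h'⟩
  · exact absurd h (by simp)
  · simp only at h h' ⊢
    subst h'
    rcases hex _ _ h with h | h
    · obtain ⟨e', he', ht⟩ := toF e he
      refine ⟨e', (hXz _).2 (Or.inl he'), ht, z⁻¹, inv_mem_letters.2 hz, ?_⟩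
      rw [hXz, map_inv, ← hζ]
      right
      have : (1 * ζ ^ (2 * ex l) * q i)⁻¹ * (1 * ζ ^ (2 * ex k) * q i * e' * ζ⁻¹) * ζ⁻¹ = e' := by
        rw [h, mul_add, zpow_add]
        simp [mul_assoc, mul_comm, mul_left_comm, zpow_ofNat, pow_two]
      rwa [this]
    · obtain ⟨e', he', ht⟩ := toFz e he
      refine ⟨e', (hXz _).2 (Or.inr he'), ht, z, hz, ?_⟩
      rw [hXz, ← hζ]
      left
      have : (1 * ζ ^ (2 * ex l) * q i)⁻¹ * (1 * ζ ^ (2 * ex k) * q i * e' * ζ) = e' * ζ⁻¹ := by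
        rw [h, mul_add, zpow_add, eq_mul_inv_iff_mul_eq, mul_assoc, inv_mul_eq_iff_eq_mul]
        simp [mul_assoc, mul_comm, mul_left_comm, zpow_ofNat, pow_two]
      rwa [this]
  · simp only [Prod.mk.injEq] at h h' ⊢
    obtain ⟨-, rfl⟩ := h'
    obtain ⟨y, hy, hy'⟩ := hq i j h
    obtain ⟨e', he', ht⟩ := toF e he
    refine ⟨e', (hXz _).2 (Or.inl he'), ht, y, hy, ?_⟩
    rw [hXz]
    left
    have : (1 * ζ ^ (2 * ex k) * q j)⁻¹ * (1 * ζ ^ (2 * ex k) * q i * e' * Abelianization.of y)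
        = e' := by
      rw [hy']; simp [mul_assoc, mul_comm, mul_left_comm]
    rwa [this]

end

/-! ### Square blocks -/

section
variable {G : Type*} [Group G] {S : Set G}

/-- Suppose that the powers of `g = x * y` tile the subgroup `B` of `G/G'` with tile `X`, and that
the generator `u` has even or infinite order modulo `B`. The blocks congruent to `X ∪ X * u` can be
linked through the four ports `1, x, x * u, u` as soon as the preimage of a block can be traversed
along each of the four sides of this square. Infinite order is included in `heven`, as `orderOf` is
then `0`. -/
theorem exists_twoWay_of_square (hfin : S.Finite)
    (hgen : Subgroup.closure S = ⊤) {B : Subgroup (Abelianization G)}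
    {X : Set (Abelianization G)} {x y u : G} (hy : y ∈ letters S)
    (hu : u ∈ letters S)
    (hT : Tiles B (fun k : ℤ => (Abelianization.of x * Abelianization.of y) ^ k) X)
    (heven : Even (orderOf ((Abelianization.of u : Abelianization G) : Abelianization G ⧸ B)))
    (h1 : Trav S (X ∪ (· * Abelianization.of u) '' X) 1 (Abelianization.of x))
    (h2 : Trav S (X ∪ (· * Abelianization.of u) '' X) (Abelianization.of u)
      (Abelianization.of x * Abelianization.of u))
    (h3 : Trav S (X ∪ (· * Abelianization.of u) '' X) 1 (Abelianization.of u))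
    (h4 : Trav S (X ∪ (· * Abelianization.of u) '' X) (Abelianization.of x)
      (Abelianization.of x * Abelianization.of u)) :
    ∃ x : ℤ → G, IsTwoWayHamiltonianPath (mulCayley S) x := by
  set ξ := Abelianization.of x
  set η := Abelianization.of y with hη
  set υ := Abelianization.of u with hυ
  set Y := X ∪ (· * υ) '' X
  obtain ⟨n, hn⟩ := heven
  rw [← two_mul] at hn
  obtain ⟨κ, Q, ex, hQ, -, hex, hres⟩ := exists_traceable_residues n
  obtain ⟨ι, P, q, hP, hq, hPT⟩ := exists_transversal hfin hgen (B ⊔ Subgroup.zpowers υ)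
  have htile := (hT.domino hn hres).prod hPT
  have hΓ := exists_twoWay_boxProd (exists_twoWay_boxProd ⟨_, isTwoWay_intLine⟩ hQ) hP
  let E : Set (Abelianization G) := {1, ξ, υ, ξ * υ}
  have e1 : (1 : Abelianization G) ∈ E := by simp [E]
  have ex' : ξ ∈ E := by simp [E]
  have eu : υ ∈ E := by simp [E]
  have exu : ξ * υ ∈ E := by simp [E]
  -- from every port the traversal can be made to end on any prescribed side of the square
  have toR : ∀ e ∈ E, ∃ e', (e' = ξ ∨ e' = ξ * υ) ∧ Trav S Y e e' := by
    rintro e (rfl | rfl | rfl | rfl)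
    · exact ⟨_, Or.inl rfl, h1⟩
    · exact ⟨_, Or.inr rfl, h4⟩
    · exact ⟨_, Or.inr rfl, h2⟩
    · exact ⟨_, Or.inl rfl, h4.symm⟩
  have toL : ∀ e ∈ E, ∃ e', (e' = 1 ∨ e' = υ) ∧ Trav S Y e e' := by
    rintro e (rfl | rfl | rfl | rfl)
    · exact ⟨_, Or.inr rfl, h3⟩
    · exact ⟨_, Or.inl rfl, h1.symm⟩
    · exact ⟨_, Or.inl rfl, h3.symm⟩
    · exact ⟨_, Or.inr rfl, h2.symm⟩
  have toU : ∀ e ∈ E, ∃ e', (e' = υ ∨ e' = ξ * υ) ∧ Trav S Y e e' := by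
    rintro e (rfl | rfl | rfl | rfl)
    · exact ⟨_, Or.inl rfl, h3⟩
    · exact ⟨_, Or.inr rfl, h4⟩
    · exact ⟨_, Or.inr rfl, h2⟩
    · exact ⟨_, Or.inl rfl, h2.symm⟩
  have toD : ∀ e ∈ E, ∃ e', (e' = 1 ∨ e' = ξ) ∧ Trav S Y e e' := by
    rintro e (rfl | rfl | rfl | rfl)
    · exact ⟨_, Or.inr rfl, h1⟩
    · exact ⟨_, Or.inl rfl, h1.symm⟩
    · exact ⟨_, Or.inl rfl, h3.symm⟩
    · exact ⟨_, Or.inl rfl |>.symm, h4.symm⟩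
  refine exists_twoWay_of_tiles hΓ htile (E := E) ⟨1, e1⟩ ?_
  rintro ⟨⟨k, l⟩, i⟩ ⟨⟨k', l'⟩, j⟩ hadj e he
  rw [boxProd_adj, boxProd_adj] at hadj
  rcases hadj with ⟨⟨h, h''⟩ | ⟨h, h''⟩, h'⟩ | ⟨h, h'⟩
  · simp only at h h' h'' ⊢
    subst h' h''
    have key : ∀ {k k' : ℤ} {a b}, k' = k + 1 → a * η = (ξ * η) * b →
        ((ξ * η) ^ k' * υ ^ (2 * ex l) * q i)⁻¹ * ((ξ * η) ^ k * υ ^ (2 * ex l) * q i * a * η)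
          = b := by
      intro k k' a b hk hab
      rw [hk, zpow_add_one, inv_mul_eq_iff_eq_mul, mul_assoc, hab]
      simp only [mul_assoc, mul_comm, mul_left_comm]
    have key' : ∀ {k k' : ℤ} {a b}, k = k' + 1 → (ξ * η) * a = b * η →
        ((ξ * η) ^ k' * υ ^ (2 * ex l) * q i)⁻¹ * ((ξ * η) ^ k * υ ^ (2 * ex l) * q i * a * η⁻¹)
          = b := by
      intro k k' a b hk hab
      rw [hk, zpow_add_one, inv_mul_eq_iff_eq_mul, mul_inv_eq_iff_eq_mul, mul_assoc _ b, ← hab]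
      simp only [mul_assoc, mul_comm, mul_left_comm]
    rcases h with h | h
    · obtain ⟨e', rfl | rfl, ht⟩ := toL e he
      · exact ⟨_, e1, ht, y⁻¹, inv_mem_letters.2 hy, by
          rw [map_inv, ← hη, key' (b := ξ) h (by simp)]; exact ex'⟩
      · exact ⟨_, eu, ht, y⁻¹, inv_mem_letters.2 hy, by
          rw [map_inv, ← hη, key' (b := ξ * υ) h (by simp [mul_comm, mul_left_comm])]; exact exu⟩
    · obtain ⟨e', rfl | rfl, ht⟩ := toR e he
      · exact ⟨_, ex', ht, y, hy, by rw [← hη, key (b := 1) h (by simp)]; exact e1⟩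
      · exact ⟨_, exu, ht, y, hy, by
          rw [← hη, key (b := υ) h (by simp [mul_comm, mul_left_comm])]; exact eu⟩
  · simp only at h h' h'' ⊢
    subst h' h''
    have key : ∀ {a}, ex l' = ex l + 1 →
        ((ξ * η) ^ k * υ ^ (2 * ex l') * q i)⁻¹ * ((ξ * η) ^ k * υ ^ (2 * ex l) * q i * (a * υ) * υ)
          = a := by
      intro a hk
      rw [hk, mul_add, zpow_add, inv_mul_eq_iff_eq_mul]
      simp [mul_assoc, mul_comm, mul_left_comm, zpow_ofNat, pow_two]
    have key' : ∀ {a}, ex l = ex l' + 1 →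
        ((ξ * η) ^ k * υ ^ (2 * ex l') * q i)⁻¹ * ((ξ * η) ^ k * υ ^ (2 * ex l) * q i * a * υ⁻¹)
          = a * υ := by
      intro a hk
      rw [hk, mul_add, zpow_add, inv_mul_eq_iff_eq_mul, mul_inv_eq_iff_eq_mul]
      simp [mul_assoc, mul_comm, mul_left_comm, zpow_ofNat, pow_two]
    rcases hex _ _ h with h | h
    · obtain ⟨e', rfl | rfl, ht⟩ := toD e he
      · exact ⟨_, e1, ht, u⁻¹, inv_mem_letters.2 hu, by
          rw [map_inv, ← hυ, key' h, one_mul]; exact eu⟩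
      · exact ⟨_, ex', ht, u⁻¹, inv_mem_letters.2 hu, by
          rw [map_inv, ← hυ, key' h]; exact exu⟩
    · obtain ⟨e', rfl | rfl, ht⟩ := toU e he
      · exact ⟨_, eu, ht, u, hu, by
          have := key (a := 1) h
          rw [one_mul] at this
          rw [← hυ, this]; exact e1⟩
      · exact ⟨_, exu, ht, u, hu, by rw [← hυ, key h]; exact ex'⟩
  · simp only [Prod.mk.injEq] at h h' ⊢
    obtain ⟨rfl, rfl⟩ := h'
    obtain ⟨z, hz, hz'⟩ := hq i j h
    obtain ⟨e', he', ht⟩ := toL e he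
    have he'E : e' ∈ E := by rcases he' with rfl | rfl <;> assumption
    refine ⟨e', he'E, ht, z, hz, ?_⟩
    have : ((ξ * η) ^ k * υ ^ (2 * ex l) * q j)⁻¹ *
        ((ξ * η) ^ k * υ ^ (2 * ex l) * q i * e' * Abelianization.of z) = e' := by
      rw [hz', inv_mul_eq_iff_eq_mul]; simp only [mul_assoc, mul_comm, mul_left_comm]
    rwa [this]

/-- Two noncommuting generators `s` and `u`, with `s` of infinite order modulo `G'` and `u` of even
or infinite order modulo `s`: the square `1, s, s * u, u` is traced by the commutator. -/
theorem exists_twoWay_of_even_of_not_commute (hfin : S.Finite)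
    (hgen : Subgroup.closure S = ⊤) {p : ℕ} (hp : p.Prime) (hc : Nat.card (commutator G) = p)
    {s u : G} (hs : s ∈ letters S) (hu : u ∈ letters S) (hso : orderOf (Abelianization.of s) = 0)
    (hsu : ¬ Commute s u)
    (heven : Even (orderOf ((Abelianization.of u : Abelianization G) :
      Abelianization G ⧸ Subgroup.zpowers (Abelianization.of s)))) :
    ∃ x : ℤ → G, IsTwoWayHamiltonianPath (mulCayley S) x := by
  set σ := Abelianization.of s with hσ
  set υ := Abelianization.of u with hυ
  have hinj : Function.Injective (fun k : ℤ => σ ^ k) :=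
    injective_zpow_iff_not_isOfFinOrder.2 (orderOf_eq_zero_iff.1 hso)
  have hT : Tiles (Subgroup.zpowers σ) (fun k : ℤ => (σ * σ) ^ k) {1, σ} := by
    refine ⟨fun k a ha => ?_, fun a ha => ?_⟩
    · have h1 : (σ * σ) ^ k ∈ Subgroup.zpowers σ := ⟨2 * k, by
        simp [zpow_mul, zpow_ofNat, pow_two]⟩
      rcases ha with rfl | rfl
      · exact mul_mem h1 (one_mem _)
      · exact mul_mem h1 (Subgroup.mem_zpowers _)
    · obtain ⟨n, rfl⟩ := ha
      have key : ∀ k : ℤ, ((σ * σ) ^ k)⁻¹ * σ ^ n ∈ ({1, σ} : Set (Abelianization G)) ↔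
          n - 2 * k = 0 ∨ n - 2 * k = 1 := by
        intro k
        have h1 : ((σ * σ) ^ k)⁻¹ * σ ^ n = σ ^ (n - 2 * k) := by
          rw [← pow_two, ← zpow_ofNat, ← zpow_mul, zpow_sub, mul_comm]
        rw [h1, Set.mem_insert_iff, Set.mem_singleton_iff]
        have h2 := hinj.eq_iff (a := n - 2 * k) (b := 0)
        have h3 := hinj.eq_iff (a := n - 2 * k) (b := 1)
        simp only [zpow_zero, zpow_one] at h2 h3
        rw [h2, h3]
      refine ⟨n / 2, (key _).2 (by omega), fun k hk => ?_⟩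
      have := (key k).1 hk
      omega
  have hσ1 : σ ≠ 1 := by
    intro h; rw [h, orderOf_one] at hso; exact one_ne_zero hso
  have huB : υ ∉ Subgroup.zpowers σ := by
    intro h
    have : ((υ : Abelianization G) : Abelianization G ⧸ Subgroup.zpowers σ) = 1 :=
      (QuotientGroup.eq_one_iff _).2 h
    rw [this, orderOf_one] at heven
    exact absurd heven (by decide)
  have hX : ({1, σ} : Set (Abelianization G)) ∪ (· * υ) '' {1, σ} = {1, σ, σ * υ, υ} := by
    ext a
    simp only [Set.image_insert_eq, Set.image_singleton, one_mul, Set.mem_union,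
      Set.mem_insert_iff, Set.mem_singleton_iff]
    tauto
  have hυ1 : υ ≠ 1 := fun h => huB (h ▸ one_mem _)
  have hυσ : υ ≠ σ := fun h => huB (h ▸ Subgroup.mem_zpowers _)
  have hσυ : σ * υ ≠ 1 := fun h => huB (by
    rw [mul_eq_one_iff_eq_inv'] at h
    rw [h]; exact inv_mem (Subgroup.mem_zpowers _))
  have hW : IsTwistedCycle S ({1, σ} ∪ (· * υ) '' {1, σ}) 1 [s, u, s⁻¹, u⁻¹] := by
    have htr : openTrace (1 : Abelianization G) ([s, u, s⁻¹, u⁻¹].map Abelianization.of) =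
        [1, σ, σ * υ, υ] := by
      simp [openTrace, ← hσ, ← hυ]
    refine ⟨?_, ?_, ?_, ?_, ?_⟩
    · simp [hs, hu, inv_mem_letters]
    · rw [htr]
      simp [hσ1, hυ1, Ne.symm hσ1, Ne.symm hυ1, Ne.symm hυσ, Ne.symm hσυ]
    · rw [htr, hX]; simp
    · simp
    · intro h
      apply hsu
      rw [Commute, SemiconjBy]
      have h' : s * u * s⁻¹ * u⁻¹ = 1 := by simpa [mul_assoc] using h
      rw [mul_inv_eq_one, mul_inv_eq_iff_eq_mul] at h'
      exact h'
  refine exists_twoWay_of_square (x := s) (y := s) hfin hgen hs hu hT heven ?_ ?_ ?_ ?_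
  · exact hW.trav hp hc (V := []) (by simp) (by simp)
  · exact (hW.trav hp hc (V := [s, u]) (x := s⁻¹) (W := [u⁻¹]) (f := σ * υ) (f' := υ)
      (by simp [hσ, hυ]) (by simp [hσ])).symm
  · exact (hW.trav hp hc (V := [s, u, s⁻¹]) (x := u⁻¹) (W := []) (f := υ) (f' := 1)
      (by simp [hυ]) (by simp [hυ])).symm
  · exact (hW.trav hp hc (V := [s]) (x := u) (W := [s⁻¹, u⁻¹]) (f := σ) (f' := σ * υ)
      (by simp [hσ]) (by simp [hυ]))

end

/-! ### Subgroups of odd index, and prisms over cycles -/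

section
variable {G : Type*} [Group G] {S : Set G}

/-- Translates of a block that are arranged along a path can be traversed one after the other, in
alternating directions. -/
theorem exists_trav_iUnion {ι : Type*} {q : ι → Abelianization G} {X : Set (Abelianization G)}
    {R : ι → ι → Prop} (hR : ∀ i j, R i j → ∃ x ∈ letters S, q j = q i * Abelianization.of x)
    (hd : ∀ i j a, (q i)⁻¹ * a ∈ X → (q j)⁻¹ * a ∈ X → i = j) :
    ∀ (l : List ι) (e e' : Abelianization G), Trav S X e e' → l.Nodup → l.IsChain R →
      ∀ i ∈ l.head?, ∀ j ∈ l.getLast?,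
        Trav S {a | ∃ k ∈ l, (q k)⁻¹ * a ∈ X} (q i * e)
          (q j * if Odd l.length then e' else e) := by
  intro l
  induction l with
  | nil => simp
  | cons i l ih =>
    intro e e' h hn hch i' hi' j hj
    simp only [List.head?_cons, Option.mem_some_iff] at hi'
    subst hi'
    cases l with
    | nil =>
      simp only [List.getLast?_singleton, Option.mem_some_iff] at hj
      subst hj
      simpa using h.translate (Y := {a | (q i)⁻¹ * a ∈ X}) (q i) fun _ => Iff.rfl
    | cons k l =>
      rw [List.nodup_cons] at hn
      rw [List.isChain_cons_cons] at hch
      obtain ⟨x, hx, hxk⟩ := hR _ _ hch.1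
      have h1 := h.translate (Y := {a | (q i)⁻¹ * a ∈ X}) (q i) fun _ => Iff.rfl
      have h2 := ih e' e h.symm hn.2 hch.2 k rfl j (by simpa using hj)
      have h3 := h1.append h2 (Set.disjoint_left.2 fun a ha ⟨m, hm, hma⟩ => by
        have := hd _ _ _ ha hma
        exact hn.1 (this ▸ hm)) hx (by rw [hxk, mul_right_comm])
      have hset : {a | ∃ m ∈ i :: k :: l, (q m)⁻¹ * a ∈ X} =
          {a | (q i)⁻¹ * a ∈ X} ∪ {a | ∃ m ∈ k :: l, (q m)⁻¹ * a ∈ X} := by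
        ext a
        simp
      have hodd : (if Odd (i :: k :: l).length then e' else e) =
          if Odd (k :: l).length then e else e' := by
        by_cases ho : Odd (k :: l).length
        · rw [if_pos ho, if_neg]
          rwa [List.length_cons (a := i), Nat.odd_add_one, not_not]
        · rw [if_neg ho, if_pos]
          rwa [List.length_cons (a := i), Nat.odd_add_one]
      rw [hset, hodd]
      exact h3

/-- If the powers of `g = x * y` tile a subgroup of finite odd index with a block that can be
traversed from `1` to `x`, then an odd number of translates of the block can be traversed one after
the other, and the traversal ends where the next power of `g` can be entered. -/
theorem exists_twoWay_of_odd_index (hfin : S.Finite)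
    (hgen : Subgroup.closure S = ⊤) {B : Subgroup (Abelianization G)}
    {X : Set (Abelianization G)} {x y : G} (hy : y ∈ letters S)
    (hT : Tiles B (fun k : ℤ => (Abelianization.of x * Abelianization.of y) ^ k) X)
    (hodd : Odd B.index) (h1 : Trav S X 1 (Abelianization.of x)) :
    ∃ x : ℤ → G, IsTwoWayHamiltonianPath (mulCayley S) x := by
  set ξ := Abelianization.of x
  set η := Abelianization.of y with hη
  obtain ⟨ι, P, q, hP, hq, hPT⟩ := exists_transversal hfin hgen B
  have hbij : Function.Bijective (fun i => (q i : Abelianization G ⧸ B)) := by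
    constructor
    · intro i j hij
      rw [QuotientGroup.eq] at hij
      exact (hPT.2 (q j) trivial).unique hij (by simp)
    · intro a
      obtain ⟨a, rfl⟩ := QuotientGroup.mk_surjective a
      obtain ⟨i, hi, -⟩ := hPT.2 a trivial
      exact ⟨i, QuotientGroup.eq.2 hi⟩
  have hcard : Nat.card ι = B.index := by
    rw [Subgroup.index]; exact Nat.card_eq_of_bijective _ hbij
  have hfinι : Finite ι := Nat.finite_of_card_ne_zero (by rw [hcard]; exact hodd.pos.ne')
  obtain ⟨l, hl0, hln, hlc, hlm⟩ : ∃ l, IsHamiltonianList P l := by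
    refine hP.resolve_left ?_
    rintro ⟨z, hz⟩
    have := Finite.of_injective z hz.injective
    exact not_finite ℤ
  have hlen : l.length = B.index := by
    classical
    rw [← hcard, ← List.toFinset_card_of_nodup hln, ← Set.ncard_univ, ← Set.ncard_coe_finset]
    congr 1
    ext i; simp [hlm]
  rw [← hlen] at hodd
  have hd : ∀ i j a, (q i)⁻¹ * a ∈ X → (q j)⁻¹ * a ∈ X → i = j := by
    have hXB : ∀ b ∈ X, b ∈ B := fun b hb => by simpa using hT.1 0 b hb
    intro i j a hi hj
    exact (hPT.2 a trivial).unique (hXB _ hi) (hXB _ hj)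
  obtain ⟨i₀, hi₀⟩ : ∃ i, i ∈ l.head? := ⟨_, List.head?_eq_some_head hl0⟩
  obtain ⟨j₀, hj₀⟩ : ∃ i, i ∈ l.getLast? := ⟨_, List.getLast?_eq_some_getLast hl0⟩
  have trv := fun e e' h => exists_trav_iUnion hq hd l e e' h hln hlc i₀ hi₀ j₀ hj₀
  simp only [if_pos hodd] at trv
  set Y : Set (Abelianization G) := {a | ∃ k ∈ l, (q k)⁻¹ * a ∈ X} with hY
  have t1 : Trav S Y (q i₀) (ξ * q j₀) := by
    simpa [mul_comm] using trv _ _ h1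
  have t2 : Trav S Y (ξ * q i₀) (q j₀) := by
    simpa [mul_comm] using trv _ _ h1.symm
  have hTY : Tiles ⊤ (fun k : ℤ => (ξ * η) ^ k) Y := by
    have hpr := hT.prod hPT
    refine ⟨fun _ _ _ => trivial, fun a ha => ?_⟩
    have key : ∀ (k : ℤ) i, ((ξ * η) ^ k * q i)⁻¹ * a ∈ X ↔
        (q i)⁻¹ * (((ξ * η) ^ k)⁻¹ * a) ∈ X := by
      intro k i
      rw [mul_inv, mul_assoc, mul_left_comm]
    obtain ⟨⟨k, i⟩, hki, huniq⟩ := hpr.2 a trivial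
    refine ⟨k, ⟨i, hlm i, (key _ _).1 hki⟩, ?_⟩
    rintro k' ⟨i', -, h'⟩
    have := huniq (k', i') ((key _ _).2 h')
    exact congrArg Prod.fst this
  have key : ∀ (k : ℤ) b, ((ξ * η) ^ (k + 1))⁻¹ * ((ξ * η) ^ k * (ξ * b) * η) = b := by
    intro k b
    rw [zpow_add_one, inv_mul_eq_iff_eq_mul]
    simp only [mul_assoc, mul_comm, mul_left_comm]
  have key' : ∀ (k : ℤ) b, ((ξ * η) ^ k)⁻¹ * ((ξ * η) ^ (k + 1) * b * η⁻¹) = ξ * b := by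
    intro k b
    rw [zpow_add_one, inv_mul_eq_iff_eq_mul, mul_inv_eq_iff_eq_mul]
    simp only [mul_assoc, mul_comm, mul_left_comm]
  refine exists_twoWay_of_int_tiles hTY (Ep := {q i₀, q j₀}) (Em := {ξ * q i₀, ξ * q j₀})
    ?_ ?_ ?_
  · rintro k e (rfl | rfl)
    · exact ⟨_, t1, y, hy, by rw [← hη, key]; simp⟩
    · exact ⟨_, t2.symm, y, hy, by rw [← hη, key]; simp⟩
  · rintro k e (rfl | rfl)
    · exact ⟨_, t2, y⁻¹, inv_mem_letters.2 hy, by rw [map_inv, ← hη, key']; simp⟩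
    · exact ⟨_, t1.symm, y⁻¹, inv_mem_letters.2 hy, by rw [map_inv, ← hη, key']; simp⟩
  · refine ⟨ξ * q i₀, by simp, y, hy, ?_⟩
    have := key (-1) (q i₀)
    rw [neg_add_cancel] at this
    rw [← hη, this]; simp

theorem CayStep.mono {S T : Set G} (hST : letters S ⊆ letters T) {a b : G} (h : CayStep S a b) :
    CayStep T a b := hST h

theorem Trav.mono {S T : Set G} {X : Set (Abelianization G)} {e e' : Abelianization G}
    (hST : letters S ⊆ letters T) (h : Trav S X e e') : Trav T X e e' := by
  obtain ⟨l, h1, h2, h⟩ := h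
  exact ⟨l, h1, h2.imp fun _ _ hab => hab.mono hST, h⟩

/-- Let `a, …, b` be a hamiltonian cycle of the preimage of `X` whose steps commute with the letter
`u`. Right multiplication by `u` completes it to a prism, in which a hamiltonian path leads from `a`
to `b`. -/
theorem trav_union_of_cycle {T : Set G} (hTS : letters T ⊆ letters S) {u : G}
    (hu : u ∈ letters S) (hcomm : ∀ y ∈ letters T, Commute u y) {X : Set (Abelianization G)}
    (hd : Disjoint X ((· * Abelianization.of u) '' X)) {l : List G} (h1 : l.Nodup)
    (h2 : l.IsChain (CayStep T)) (h3 : ∀ g, g ∈ l ↔ Abelianization.of g ∈ X) {a b : G}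
    (ha : a ∈ l.head?) (hb : b ∈ l.getLast?) (hab : a ≠ b) (hba : CayStep T b a) :
    Trav S (X ∪ (· * Abelianization.of u) '' X) (Abelianization.of a) (Abelianization.of b) := by
  have hmul : ∀ {c d}, CayStep T c d → CayStep S (c * u) (d * u) := by
    intro c d h
    have := (hcomm _ h).eq
    unfold CayStep
    have e : (c * u)⁻¹ * (d * u) = c⁻¹ * d := by
      rw [mul_inv_rev, mul_assoc, ← mul_assoc c⁻¹, ← this, inv_mul_cancel_left]
    rw [e]; exact hTS h
  have hdis : ∀ c ∈ l, c * u ∉ l := by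
    intro c hc h
    refine Set.disjoint_left.1 hd ((h3 _).1 h) ⟨_, (h3 _).1 hc, by simp⟩
  have hmem : ∀ g, Abelianization.of g ∈ X ∪ (· * Abelianization.of u) '' X ↔
      g ∈ l ∨ g ∈ l.map (· * u) := by
    intro g
    rw [Set.mem_union, ← h3]
    refine or_congr Iff.rfl ?_
    rw [List.mem_map]
    constructor
    · rintro ⟨c, hc, hcg⟩
      refine ⟨g * u⁻¹, (h3 _).2 ?_, by simp⟩
      rw [map_mul, map_inv, ← hcg]; simpa using hc
    · rintro ⟨c, hc, rfl⟩
      exact ⟨_, (h3 _).1 hc, by simp⟩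
  have hnod : (l ++ l.map (· * u)).Nodup := by
    rw [List.nodup_append']
    refine ⟨h1, h1.map (mul_left_injective u), fun g hg hg' => ?_⟩
    obtain ⟨c, hc, rfl⟩ := List.mem_map.1 hg'
    exact hdis c hc hg
  -- for the cycle `c₀, …, cₙ` the path is `c₀, c₁, c₁u, c₀u, cₙu, …, c₂u, c₂, …, cₙ`
  suffices h : ∃ L : List G, L.Perm (l ++ l.map (· * u)) ∧ L.IsChain (CayStep S) ∧
      L.head? = some a ∧ L.getLast? = some b by
    obtain ⟨L, k1, k2, k3, k4⟩ := h
    refine ⟨L, k1.nodup_iff.2 hnod, k2, fun g => ?_, ⟨a, k3, rfl⟩, b, k4, rfl⟩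
    rw [hmem, k1.mem_iff, List.mem_append]
  match l, ha, hb, h2 with
  | [c], ha, hb, _ => simp_all
  | [c, d], ha, hb, h2 =>
    simp only [List.head?_cons, Option.mem_some_iff, List.getLast?_cons_cons,
      List.getLast?_singleton] at ha hb
    subst ha hb
    refine ⟨[c, c * u, d * u, d], ?_, ?_, rfl, rfl⟩
    · simp only [List.map_cons, List.map_nil, List.cons_append, List.nil_append]
      refine List.Perm.cons _ ?_
      exact (List.perm_append_comm (l₁ := [c * u, d * u]) (l₂ := [d]))
    · simp only [List.isChain_cons_cons, List.IsChain.singleton, and_true] at h2 ⊢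
      exact ⟨cayStep_mul hu, hmul h2, (cayStep_mul hu).symm⟩
  | c :: d :: f :: m, ha, hb, h2 =>
    simp only [List.head?_cons, Option.mem_some_iff, List.getLast?_cons_cons] at ha hb
    subst ha
    rw [List.isChain_cons_cons] at h2
    obtain ⟨h2, h2'⟩ := h2
    rw [List.isChain_cons] at h2'
    obtain ⟨h4, h5⟩ := h2'
    refine ⟨[c, d, d * u, c * u] ++ ((f :: m).map (· * u)).reverse ++ (f :: m), ?_, ?_, rfl, ?_⟩
    · rw [← Multiset.coe_eq_coe]
      simp only [← Multiset.coe_add, ← Multiset.cons_coe, List.map_cons, Multiset.coe_reverse,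
        List.cons_append]
      simp only [← Multiset.singleton_add]
      abel
    · rw [List.isChain_append, List.isChain_append, List.isChain_reverse]
      refine ⟨⟨?_, ?_, ?_⟩, h5.imp fun _ _ h => h.mono hTS, ?_⟩
      · simp only [List.isChain_cons_cons, List.IsChain.singleton, and_true]
        exact ⟨h2.mono hTS, cayStep_mul hu, (hmul h2).symm⟩
      · refine List.isChain_map_of_isChain _ (fun a b hab => ?_) h5
        exact (hmul hab).symm
      · intro x hx y hy
        simp only [List.getLast?_cons_cons, List.getLast?_singleton, Option.mem_some_iff] at hx
        rw [List.head?_reverse, List.getLast?_map, Option.mem_def, hb] at hy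
        simp only [Option.map_some, Option.some.injEq] at hy
        subst hx hy
        exact (hmul hba).symm
      · intro x hx y hy
        simp only [List.head?_cons, Option.mem_some_iff] at hy
        subst hy
        rw [List.map_cons, List.reverse_cons, ← List.append_assoc, List.getLast?_concat,
          Option.mem_some_iff] at hx
        subst hx
        exact (cayStep_mul hu).symm
    · rw [List.getLast?_append, Option.mem_def.1 hb, Option.some_or]

end

/-! ### Two generators of infinite order modulo the commutator subgroup -/

section
variable {G : Type*} [Group G] {S : Set G}

theorem IsTwistedCycle.translate {X : Set (Abelianization G)} {e : Abelianization G} {W : List G}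
    (h : IsTwistedCycle S X e W) (c : Abelianization G) :
    IsTwistedCycle S ((· * c) '' X) (e * c) W := by
  refine ⟨h.mem_letters, ?_, fun a => ?_, h.closed, h.twisted⟩
  · rw [mul_comm, openTrace_mul]
    exact h.nodup.map (mul_right_injective c)
  · rw [mul_comm, openTrace_mul, List.mem_map]
    simp only [h.mem_iff, mul_comm, Set.mem_image]

/-- A twisted cycle and its translate by a commuting letter `u` can be traversed together along any
edge of the cycle. -/
theorem IsTwistedCycle.trav_union {T : Set G} (hTS : letters T ⊆ letters S) {p : ℕ}
    (hp : p.Prime) (hc : Nat.card (commutator G) = p) {u : G}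
    (hu : u ∈ letters S) (hcomm : ∀ y ∈ letters T, Commute u y) {X : Set (Abelianization G)}
    (hd : Disjoint X ((· * Abelianization.of u) '' X)) {e : Abelianization G} {x : G} {W : List G}
    (hx : Abelianization.of x ≠ 1) (h : IsTwistedCycle T X e (x :: W)) :
    Trav S (X ∪ (· * Abelianization.of u) '' X) e (e * Abelianization.of x) := by
  have h1 : IsTwistedCycle T X (e * Abelianization.of x) (W ++ [x]) := by
    simpa using IsTwistedCycle.rotate (V := [x]) h
  obtain ⟨l, k1, k2, k3, a, ha, b, hb, ha', hb', hba⟩ := h1.exists_hamiltonian_cycle hp hc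
  have := trav_union_of_cycle hTS hu hcomm hd k1 k2 k3 ha hb
    (by rintro rfl; rw [ha', mul_inv_cancel_right] at hb'; exact hx (by simpa using hb')) hba
  rw [ha', hb', mul_inv_cancel_right] at this
  exact this.symm

theorem disjoint_image_mul_of_even {A : Type*} [CommGroup A] {B : Subgroup A} {X : Set A} {u : A}
    (hX : X ⊆ B) (heven : Even (orderOf (u : A ⧸ B))) : Disjoint X ((· * u) '' X) := by
  rw [Set.disjoint_left]
  rintro _ ha ⟨b, hb, rfl⟩
  have hu : u ∈ B := (Subgroup.mul_mem_cancel_left B (hX hb)).1 (hX ha)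
  rw [(QuotientGroup.eq_one_iff _).2 hu, orderOf_one] at heven
  exact absurd heven (by decide)

/-- A twisted cycle through a tile of a subgroup `B`, together with a generator `u` of even or
infinite order modulo `B` that commutes with the letters of the cycle. -/
theorem exists_twoWay_of_even_of_commute (hfin : S.Finite)
    (hgen : Subgroup.closure S = ⊤) {p : ℕ} (hp : p.Prime) (hc : Nat.card (commutator G) = p)
    {T : Set G} (hTS : letters T ⊆ letters S) {B : Subgroup (Abelianization G)}
    {X : Set (Abelianization G)} {x y u : G} {W : List G} (hx : Abelianization.of x ≠ 1)
    (hy : y ∈ letters S) (hu : u ∈ letters S) (hcomm : ∀ z ∈ letters T, Commute u z)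
    (hT : Tiles B (fun k : ℤ => (Abelianization.of x * Abelianization.of y) ^ k) X)
    (hW : IsTwistedCycle T X 1 (x :: W))
    (heven : Even (orderOf ((Abelianization.of u : Abelianization G) : Abelianization G ⧸ B))) :
    ∃ x : ℤ → G, IsTwoWayHamiltonianPath (mulCayley S) x := by
  have hXB : X ⊆ B := fun b hb => by simpa using hT.1 0 b hb
  have hd := disjoint_image_mul_of_even hXB heven
  have hW' := hW.translate (Abelianization.of u)
  have hXX : (· * Abelianization.of u⁻¹) '' ((· * Abelianization.of u) '' X) = X := by
    rw [Set.image_image]; simp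
  have ht : Trav S X 1 (Abelianization.of x) :=
    (IsTwistedCycle.trav hp hc (V := []) hW (by simp) (by simp)).mono hTS
  have ht' : Trav S ((· * Abelianization.of u) '' X) (Abelianization.of u)
      (Abelianization.of x * Abelianization.of u) :=
    (IsTwistedCycle.trav hp hc (V := []) hW' (by simp) (by simp [mul_comm])).mono hTS
  refine exists_twoWay_of_square hfin hgen hy hu hT heven ?_ ?_ ?_ ?_
  · simpa using hW.trav_union hTS hp hc hu hcomm hd hx
  · have := hW'.trav_union (u := u⁻¹) hTS hp hc (inv_mem_letters.2 hu)
      (fun z hz => (hcomm z hz).inv_left) (by rw [hXX]; exact hd.symm) hx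
    rw [hXX, one_mul, mul_comm (Abelianization.of u), Set.union_comm] at this
    exact this
  · exact ht.append ht'.symm hd hu rfl
  · exact ht.symm.append ht' hd hu (by simp)

/-- Since `s⁻¹` and `t` agree modulo `t * s`, the `i`-th vertex of a walk in these two letters is
congruent to `t ^ i`. -/
theorem exists_openTrace_eq_map_range {A : Type*} [CommGroup A] {s t : A} :
    ∀ (w : List A) (_ : ∀ y ∈ w, y = t ∨ y = s⁻¹) (e : A), ∃ ν : ℕ → ℤ,
      openTrace e w = (List.range w.length).map fun i => e * (t ^ i * (t * s) ^ ν i) := by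
  intro w
  induction w with
  | nil => intro _ _; exact ⟨0, rfl⟩
  | cons y w ih =>
    intro hw e
    rw [List.forall_mem_cons] at hw
    obtain ⟨ν, hν⟩ := ih hw.2 (e * y)
    obtain ⟨r, hr⟩ : ∃ r : ℤ, y = t * (t * s) ^ r := by
      rcases hw.1 with rfl | rfl
      · exact ⟨0, by simp⟩
      · exact ⟨-1, by simp⟩
    refine ⟨fun i => Nat.casesOn i 0 fun i => r + ν i, ?_⟩
    rw [openTrace, hν, List.length_cons, List.range_succ_eq_map, List.map_cons, List.map_map]
    congr 1
    · simp
    · refine List.map_congr_left fun i _ => ?_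
      simp only [Function.comp]
      rw [zpow_add, pow_succ, hr]
      simp only [mul_assoc, mul_comm, mul_left_comm]

/-- If `t` has order `L` modulo the infinite cyclic group generated by `g`, then `⟨g, t⟩` is tiled
by the powers of `g`, with a tile that contains one element of each coset `t ^ i * ⟨g⟩`. -/
theorem tiles_sup_zpowers {A : Type*} [CommGroup A] {g t : A} {L : ℕ} (hL : 0 < L)
    (hg : ∀ n : ℤ, g ^ n = 1 → n = 0) (ht : ∀ j : ℤ, t ^ j ∈ Subgroup.zpowers g ↔ (L : ℤ) ∣ j)
    (ν : ℕ → ℤ) :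
    Tiles (Subgroup.zpowers g ⊔ Subgroup.zpowers t) (fun k : ℤ => g ^ k)
      {a | ∃ i < L, a = t ^ i * g ^ ν i} := by
  refine ⟨?_, fun a ha => ?_⟩
  · rintro k _ ⟨i, -, rfl⟩
    rw [mul_left_comm, mul_comm, ← zpow_add]
    exact Subgroup.mul_mem_sup ⟨_, rfl⟩ ⟨i, by simp⟩
  · obtain ⟨_, ⟨n, rfl⟩, _, ⟨b, rfl⟩, rfl⟩ := Subgroup.mem_sup.1 ha
    simp only
    have hL' : (0 : ℤ) < L := by exact_mod_cast hL
    have h1 := Int.emod_nonneg b hL'.ne'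
    have h2 := Int.emod_lt_of_pos b hL'
    obtain ⟨r, hr⟩ := (ht (b - b % L)).2 Int.dvd_self_sub_emod
    simp only at hr
    have key : ∀ k i : ℤ, ∀ v : ℤ, (g ^ k)⁻¹ * (g ^ n * t ^ b) = t ^ i * g ^ v ↔
        t ^ (b - i) = g ^ (v + k - n) := by
      intro k i v
      rw [inv_mul_eq_iff_eq_mul, zpow_sub, zpow_sub, zpow_add, mul_inv_eq_iff_eq_mul,
        mul_right_comm, eq_mul_inv_iff_mul_eq]
      simp only [mul_assoc, mul_comm]
    refine ⟨n + r - ν (b % L).toNat, ⟨(b % L).toNat, by omega, ?_⟩, ?_⟩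
    · rw [← zpow_natCast t, key, Int.toNat_of_nonneg h1, ← hr]
      congr 1; ring
    · rintro k ⟨i, hi, hk⟩
      rw [← zpow_natCast t, key] at hk
      obtain ⟨c, hc⟩ := (ht (b - i)).1 ⟨_, hk.symm⟩
      have hib : (i : ℤ) = b % L := by
        have : b = i + L * c := by omega
        rw [this, Int.add_mul_emod_self_left, Int.emod_eq_of_lt (by omega) (by exact_mod_cast hi)]
      have hi' : (b % L).toNat = i := by omega
      rw [hi']
      rw [hib, ← hr, ← mul_inv_eq_one, ← zpow_neg, ← zpow_add] at hk
      have := hg _ hk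
      omega

theorem nodup_map_range_mul_zpow {A : Type*} [CommGroup A] {g t : A} {L : ℕ}
    (ht : ∀ j : ℤ, t ^ j ∈ Subgroup.zpowers g → (L : ℤ) ∣ j) (ν : ℕ → ℤ) :
    ((List.range L).map fun i => t ^ i * g ^ ν i).Nodup := by
  refine List.Nodup.map_on ?_ List.nodup_range
  intro i hi j hj h
  rw [List.mem_range] at hi hj
  obtain ⟨c, hc⟩ := ht (i - j) ⟨ν j - ν i, by
    simp only
    rw [zpow_sub, zpow_sub, mul_inv_eq_iff_eq_mul, mul_right_comm, eq_mul_inv_iff_mul_eq,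
      zpow_natCast, zpow_natCast, h, mul_comm]⟩
  have hc0 : c = 0 := by
    have h1 : (L : ℤ) * c < L * 1 := by omega
    have h2 : (L : ℤ) * (-1) < L * c := by omega
    have := lt_of_mul_lt_mul_left h1 (by omega)
    have := lt_of_mul_lt_mul_left h2 (by omega)
    omega
  rw [hc0, mul_zero] at hc
  omega

/-- A subgroup modulo which each of finitely many generators has odd order has odd index. -/
theorem odd_index_of_odd_orderOf {A : Type*} [CommGroup A] {U : Set A} (hU : U.Finite)
    (hgen : Subgroup.closure U = ⊤) {B : Subgroup A}
    (hodd : ∀ u ∈ U, Odd (orderOf (u : A ⧸ B))) : Odd B.index := by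
  have hfg : Group.FG A := Group.fg_iff.2 ⟨U, hgen, hU⟩
  have hall : ∀ a : A, Odd (orderOf (a : A ⧸ B)) := by
    intro a
    have ha : a ∈ Subgroup.closure U := by rw [hgen]; trivial
    induction ha using Subgroup.closure_induction with
    | mem u hu => exact hodd u hu
    | one => simp
    | mul a b _ _ iha ihb =>
      rw [QuotientGroup.mk_mul]
      exact Odd.of_dvd_nat (iha.mul ihb) ((Commute.all _ _).orderOf_mul_dvd_mul_orderOf)
    | inv a _ ih => rwa [QuotientGroup.mk_inv, orderOf_inv]
  have hfin : Finite (A ⧸ B) := CommGroup.finite_of_fg_isMulTorsion _ fun a => by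
    obtain ⟨a, rfl⟩ := QuotientGroup.mk_surjective a
    exact orderOf_pos_iff.1 (hall a).pos
  by_contra h
  rw [Nat.not_odd_iff_even, Subgroup.index] at h
  obtain ⟨a, ha⟩ := exists_prime_orderOf_dvd_card' 2 h.two_dvd
  obtain ⟨a, rfl⟩ := QuotientGroup.mk_surjective a
  have := hall a
  rw [ha] at this
  exact absurd this (by decide)

theorem even_orderOf_mk_of_le {A : Type*} [CommGroup A] {B C : Subgroup A} (h : B ≤ C) {u : A}
    (heven : Even (orderOf (u : A ⧸ C))) : Even (orderOf (u : A ⧸ B)) := by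
  refine heven.trans_dvd ?_
  have := (zpow_mem_iff_orderOf_dvd C u (orderOf (u : A ⧸ B))).1
    (h ((zpow_mem_iff_orderOf_dvd B u _).2 dvd_rfl))
  exact_mod_cast this

/-- Noncommuting generators `s` and `t` of infinite order modulo `G'` with `t ^ m = s ^ k` there,
where `m` is the order of `t` modulo `s`. A twisted cycle with `m` letters `t` and `k` letters `s⁻¹`
traces a tile of `⟨s, t⟩` modulo the powers of `t * s`; the remaining generators either all have odd
order modulo `⟨s, t⟩`, or one of even order supplies a square. -/
theorem exists_twoWay_of_odd_of_pow_eq_pow (hfin : S.Finite)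
    (hgen : Subgroup.closure S = ⊤) {p : ℕ} (hp : p.Prime) (hc : Nat.card (commutator G) = p)
    {s t : G} (hs : s ∈ letters S) (ht : t ∈ letters S) (hso : orderOf (Abelianization.of s) = 0)
    (hto : orderOf (Abelianization.of t) = 0) (hst : ¬ Commute s t) {m k : ℕ} (hm0 : 0 < m)
    (hk0 : 0 < k)
    (hm : ∀ j : ℤ, Abelianization.of t ^ j ∈ Subgroup.zpowers (Abelianization.of s) → (m : ℤ) ∣ j)
    (hmk : Abelianization.of t ^ m = Abelianization.of s ^ k) :
    ∃ x : ℤ → G, IsTwoWayHamiltonianPath (mulCayley S) x := by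
  set σ := Abelianization.of s with hσ
  set τ := Abelianization.of t with hτ
  have hinj : Function.Injective (fun k : ℤ => σ ^ k) :=
    injective_zpow_iff_not_isOfFinOrder.2 (orderOf_eq_zero_iff.1 hso)
  have hmkz : τ ^ (m : ℤ) = σ ^ (k : ℤ) := by simpa using hmk
  -- the relations between `τ` and `τ * σ`
  have rel : ∀ j n : ℤ, τ ^ j = (τ * σ) ^ n → ∃ c, j - n = m * c ∧ n = k * c := by
    intro j n h
    have h1 : τ ^ (j - n) = σ ^ n := by
      rw [zpow_sub, h, mul_zpow, mul_right_comm, mul_inv_cancel, one_mul]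
    obtain ⟨c, hc⟩ := hm (j - n) ⟨n, h1.symm⟩
    refine ⟨c, hc, hinj ?_⟩
    simp only
    rw [← h1, hc, zpow_mul, hmkz, ← zpow_mul]
  have hg : ∀ n : ℤ, (τ * σ) ^ n = 1 → n = 0 := by
    intro n hn
    obtain ⟨c, h1, h2⟩ := rel 0 n (by rw [zpow_zero, hn])
    have h3 : ((m + k : ℕ) : ℤ) * c = 0 := by push_cast; rw [add_mul]; omega
    rcases mul_eq_zero.1 h3 with h | h
    · omega
    · rw [h2, h, mul_zero]
  have hτg : ∀ j : ℤ, τ ^ j ∈ Subgroup.zpowers (τ * σ) ↔ ((m + k : ℕ) : ℤ) ∣ j := by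
    intro j
    constructor
    · rintro ⟨n, hn⟩
      obtain ⟨c, h1, h2⟩ := rel j n hn.symm
      exact ⟨c, by push_cast; rw [add_mul]; omega⟩
    · rintro ⟨c, rfl⟩
      refine ⟨k * c, ?_⟩
      simp only
      push_cast
      rw [add_mul, zpow_add, mul_zpow, zpow_mul τ m, hmkz, ← zpow_mul, mul_comm]
  -- two closed words in `t` and `s⁻¹`; since `s` and `t` do not commute, one of them is twisted
  obtain ⟨W, hWl, hWlen, hWc, hWt⟩ : ∃ W : List G, (∀ y ∈ t :: W, y = t ∨ y = s⁻¹) ∧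
      (t :: W).length = m + k ∧ Abelianization.of (t :: W).prod = 1 ∧ (t :: W).prod ≠ 1 := by
    obtain ⟨m, rfl⟩ : ∃ a, m = a + 1 := ⟨m - 1, by omega⟩
    obtain ⟨k, rfl⟩ : ∃ a, k = a + 1 := ⟨k - 1, by omega⟩
    by_cases h1 : t ^ (m + 1) = s ^ (k + 1)
    · obtain ⟨m, rfl⟩ : ∃ a, m = a + 1 := by
        refine ⟨m - 1, ?_⟩
        rcases Nat.eq_zero_or_pos m with rfl | h
        · exfalso
          rw [zero_add, pow_one] at h1
          exact hst (h1 ▸ (Commute.refl s).pow_right _)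
        · omega
      refine ⟨List.replicate m t ++ s⁻¹ :: t :: List.replicate k s⁻¹, ?_, ?_, ?_, ?_⟩
      · intro y hy
        simp only [List.mem_cons, List.mem_append, List.mem_replicate] at hy
        tauto
      · simp; omega
      · simp only [List.prod_cons, List.prod_append, List.prod_replicate, map_mul, map_pow,
          map_inv, ← hσ, ← hτ]
        have : τ * (τ ^ m * (σ⁻¹ * (τ * σ⁻¹ ^ k))) = τ ^ (m + 1 + 1) * (σ ^ (k + 1))⁻¹ := by
          rw [← inv_pow, pow_succ, pow_succ, pow_succ]
          simp only [mul_assoc, mul_comm, mul_left_comm]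
        rw [this, hmk, mul_inv_cancel]
      · intro h
        apply hst
        have h2 : t ^ (m + 1) * s⁻¹ * t = s ^ k := by
          simp only [List.prod_cons, List.prod_append, List.prod_replicate] at h
          rw [inv_pow] at h
          simp only [← mul_assoc] at h
          rw [mul_inv_eq_one] at h
          rw [pow_succ']; exact h
        have h3 : Commute s (t ^ (m + 1 + 1)) := h1 ▸ (Commute.refl s).pow_right _
        have h4 : t ^ (m + 1) * s⁻¹ * t = s⁻¹ * t ^ (m + 1) * t := by
          rw [h2, mul_assoc s⁻¹, ← pow_succ, h1, pow_succ' s k, inv_mul_cancel_left]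
        have h5 : Commute s⁻¹ (t ^ (m + 1)) := (mul_right_cancel h4).symm
        have h6 := h5.inv_left
        rw [inv_inv] at h6
        have h7 : t = t ^ (m + 1 + 1) * (t ^ (m + 1))⁻¹ := by rw [pow_succ' t (m + 1)]; simp
        rw [h7]
        exact h3.mul_right h6.inv_right
    · refine ⟨List.replicate m t ++ List.replicate (k + 1) s⁻¹, ?_, ?_, ?_, ?_⟩
      · intro y hy
        simp only [List.mem_cons, List.mem_append, List.mem_replicate] at hy
        tauto
      · simp; omega
      · simp only [List.prod_cons, List.prod_append, List.prod_replicate, map_mul, map_pow,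
          map_inv, ← hσ, ← hτ]
        rw [← mul_assoc, ← pow_succ', hmk, inv_pow, mul_inv_cancel]
      · intro h
        simp only [List.prod_cons, List.prod_append, List.prod_replicate] at h
        rw [← mul_assoc, ← pow_succ', inv_pow, mul_inv_eq_one] at h
        exact h1 h
  obtain ⟨ν, hν⟩ := exists_openTrace_eq_map_range (s := σ) (t := τ)
    ((t :: W).map Abelianization.of) (by
      intro y hy
      obtain ⟨z, hz, rfl⟩ := List.mem_map.1 hy
      rcases hWl z hz with rfl | rfl
      · exact Or.inl rfl
      · exact Or.inr (by rw [map_inv])) 1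
  rw [List.length_map, hWlen] at hν
  simp only [one_mul] at hν
  have hT := tiles_sup_zpowers (show 0 < m + k by omega) hg hτg ν
  have hW : IsTwistedCycle {s, t} {a | ∃ i < m + k, a = τ ^ i * (τ * σ) ^ ν i} 1 (t :: W) := by
    refine ⟨?_, ?_, ?_, hWc, hWt⟩
    · intro y hy
      rcases hWl y hy with rfl | rfl
      · exact Or.inl (by simp)
      · exact Or.inr (by simp)
    · rw [hν]; exact nodup_map_range_mul_zpow (fun j => (hτg j).1) ν
    · intro a
      rw [hν, List.mem_map]
      simp only [List.mem_range, Set.mem_ofPred_eq, eq_comm]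
  have hTS : letters {s, t} ⊆ letters S := by
    rintro y ((rfl | rfl) | (h | h))
    · exact hs
    · exact ht
    · rw [← inv_mem_letters, h]; exact hs
    · rw [← inv_mem_letters, h]; exact ht
  have hτ1 : τ ≠ 1 := by
    intro h; rw [h, orderOf_one] at hto; exact one_ne_zero hto
  set H := Subgroup.zpowers (τ * σ) ⊔ Subgroup.zpowers τ with hH
  have hτH : Subgroup.zpowers τ ≤ H := le_sup_right
  have hσH : Subgroup.zpowers σ ≤ H := by
    rw [Subgroup.zpowers_le]
    have h1 : τ * σ ∈ H := Subgroup.mem_sup_left (Subgroup.mem_zpowers _)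
    exact (Subgroup.mul_mem_cancel_left H (hτH (Subgroup.mem_zpowers _))).1 h1
  by_cases hall : ∀ u ∈ S, Odd (orderOf ((Abelianization.of u : Abelianization G) :
      Abelianization G ⧸ H))
  · refine exists_twoWay_of_odd_index (x := t) (y := s) hfin hgen hs hT ?_ ?_
    · refine odd_index_of_odd_orderOf (hfin.image Abelianization.of)
        (closure_image_abelianization hgen) ?_
      rintro _ ⟨u, hu, rfl⟩
      exact hall u hu
    · exact (IsTwistedCycle.trav hp hc (V := []) hW (by simp) (by simp)).mono hTS
  · push Not at hall
    obtain ⟨u, hu, hue⟩ := hall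
    rw [Nat.not_odd_iff_even] at hue
    by_cases hsu : Commute s u
    · by_cases htu : Commute t u
      · refine exists_twoWay_of_even_of_commute (x := t) (y := s) hfin hgen hp hc hTS hτ1 hs
          (subset_letters hu) ?_ hT hW hue
        rintro y ((rfl | rfl) | (h | h))
        · exact hsu.symm
        · exact htu.symm
        · rw [← inv_inv y, h]; exact hsu.symm.inv_right
        · rw [← inv_inv y, h]; exact htu.symm.inv_right
      · exact exists_twoWay_of_even_of_not_commute hfin hgen hp hc ht (subset_letters hu) hto htu
          (even_orderOf_mk_of_le hτH hue)
    · exact exists_twoWay_of_even_of_not_commute hfin hgen hp hc hs (subset_letters hu) hso hsu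
        (even_orderOf_mk_of_le hσH hue)

/-- Two noncommuting generators of infinite order modulo `G'`. -/
theorem exists_twoWay_of_infinite_order_of_infinite_order (hfin : S.Finite)
    (hgen : Subgroup.closure S = ⊤) {p : ℕ} (hp : p.Prime) (hc : Nat.card (commutator G) = p)
    {s t : G} (hs : s ∈ letters S) (ht : t ∈ letters S) (hso : orderOf (Abelianization.of s) = 0)
    (hto : orderOf (Abelianization.of t) = 0) (hst : ¬ Commute s t) :
    ∃ x : ℤ → G, IsTwoWayHamiltonianPath (mulCayley S) x := by
  set σ := Abelianization.of s with hσ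
  set τ := Abelianization.of t with hτ
  rcases Nat.even_or_odd (orderOf ((τ : Abelianization G) :
      Abelianization G ⧸ Subgroup.zpowers σ)) with he | ho
  · exact exists_twoWay_of_even_of_not_commute hfin hgen hp hc hs ht hso hst he
  · set m := orderOf ((τ : Abelianization G) : Abelianization G ⧸ Subgroup.zpowers σ) with hm
    have hmem := fun j => zpow_mem_iff_orderOf_dvd (Subgroup.zpowers σ) τ j
    rw [← hm] at hmem
    obtain ⟨k, hk⟩ := (hmem m).2 dvd_rfl
    simp only [zpow_natCast] at hk
    have hm0 : 0 < m := ho.pos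
    rcases lt_trichotomy k 0 with h | rfl | h
    · obtain ⟨k, rfl⟩ : ∃ n : ℕ, k = -n := ⟨(-k).toNat, by omega⟩
      refine exists_twoWay_of_odd_of_pow_eq_pow (s := s⁻¹) (k := k) hfin hgen hp hc
        (inv_mem_letters.2 hs) ht (by rwa [map_inv, orderOf_inv]) hto
        (fun h => hst (by simpa using h.inv_left)) hm0 (by omega) ?_ ?_
      · intro j hj
        rw [map_inv, Subgroup.zpowers_inv] at hj
        exact (hmem j).1 hj
      · rw [← hτ, ← hk, map_inv, ← hσ]; simp
    · rw [zpow_zero] at hk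
      exact absurd (isOfFinOrder_iff_pow_eq_one.2 ⟨m, hm0, hk.symm⟩) (orderOf_eq_zero_iff.1 hto)
    · lift k to ℕ using h.le
      exact exists_twoWay_of_odd_of_pow_eq_pow (k := k) hfin hgen hp hc hs ht hso hto hst hm0
        (by omega) (fun j hj => (hmem j).1 hj) (by rw [← hτ, ← hk, zpow_natCast])

end

/-! ### Generators of finite order, and mixed pairs -/

theorem mul_pow_mem_openTrace_replicate {M : Type*} [Monoid M] (e t : M) {j n : ℕ} (h : j < n) :
    e * t ^ j ∈ openTrace e (List.replicate n t) := by
  induction n generalizing e j with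
  | zero => omega
  | succ n ih =>
    rw [List.replicate_succ, openTrace, List.mem_cons]
    cases j with
    | zero => simp
    | succ j =>
      right
      rw [pow_succ', ← mul_assoc]
      exact ih _ (by omega)

theorem exists_pow_eq_of_mem_zpowers {A : Type*} [Group A] {t a : A} (ht : 0 < orderOf t)
    (ha : a ∈ Subgroup.zpowers t) : ∃ j < orderOf t, t ^ j = a := by
  classical
  have := (orderOf_pos_iff.1 ht).mem_zpowers_iff_mem_range_orderOf.1 ha
  simpa using this

/-- The steps of a word are alternately preceded by `z⁻¹` and `z`. -/
def zigzag {G : Type*} [Group G] : G → List G → List G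
  | _, [] => []
  | z, x :: w => z⁻¹ :: x :: zigzag z⁻¹ w

theorem map_zigzag {G H : Type*} [Group G] [Group H] (f : G →* H) (z : G) (w : List G) :
    (zigzag z w).map f = zigzag (f z) (w.map f) := by
  induction w generalizing z with
  | nil => rfl
  | cons x w ih => simp [zigzag, ih]

theorem length_zigzag {G : Type*} [Group G] (z : G) (w : List G) :
    (zigzag z w).length = 2 * w.length := by
  induction w generalizing z with
  | nil => rfl
  | cons x w ih => simp [zigzag, ih]; omega

theorem mem_zigzag {G : Type*} [Group G] {z y : G} {w : List G} (h : y ∈ zigzag z w) :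
    y = z ∨ y = z⁻¹ ∨ y ∈ w := by
  induction w generalizing z with
  | nil => simp [zigzag] at h
  | cons x w ih =>
    simp only [zigzag, List.mem_cons] at h ⊢
    rcases h with h | h | h
    · tauto
    · tauto
    · have := ih h
      rw [inv_inv] at this
      tauto

theorem prod_zigzag {G : Type*} [Group G] {z : G} {w : List G} (h : ∀ x ∈ w, Commute z x) :
    (zigzag z w).prod = w.prod * if Even w.length then 1 else z⁻¹ := by
  induction w generalizing z with
  | nil => simp [zigzag]
  | cons x w ih =>
    rw [List.forall_mem_cons] at h
    have hw : Commute z⁻¹ w.prod := (Commute.list_prod_right _ _ h.2).inv_left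
    rw [zigzag, List.prod_cons, List.prod_cons, ih fun y hy => (h.2 y hy).inv_left, inv_inv,
      List.prod_cons, ← mul_assoc, ← mul_assoc, h.1.inv_left.eq, mul_assoc x, hw.eq]
    by_cases he : Even w.length
    · rw [if_pos he, if_neg]
      · simp [mul_assoc]
      · rw [List.length_cons, Nat.even_add_one]; simpa using he
    · rw [if_neg he, if_pos]
      · simp [mul_assoc]
      · rw [List.length_cons, Nat.even_add_one]; simpa using he

/-- The zigzag visits every vertex of the original walk and its translate by `z⁻¹`. -/
theorem mem_openTrace_zigzag {A : Type*} [CommGroup A] (z : A) (w : List A) (g v : A)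
    (h : v ∈ openTrace g w) :
    v ∈ openTrace g (zigzag z w) ∧ v * z⁻¹ ∈ openTrace g (zigzag z w) := by
  induction w generalizing z g v with
  | nil => simp [openTrace] at h
  | cons x w ih =>
    simp only [openTrace, List.mem_cons, zigzag] at h ⊢
    rcases h with rfl | h
    · exact ⟨Or.inl rfl, Or.inr (Or.inl rfl)⟩
    · have h' : z⁻¹ * v ∈ openTrace (g * z⁻¹ * x) w := by
        rw [mul_comm g, mul_assoc, openTrace_mul]
        exact List.mem_map_of_mem h
      have := ih z⁻¹ _ _ h'
      rw [inv_inv, inv_mul_cancel_comm] at this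
      rw [mul_comm v]
      exact ⟨Or.inr (Or.inr this.2), Or.inr (Or.inr this.1)⟩

/-- Walking back along a path passes all its vertices except for the initial one. -/
theorem mem_openTrace_reverse {G : Type*} [Group G] (R : List G) (e v : G)
    (h : v ∈ openTrace e R ∨ v = e * R.prod) :
    v = e ∨ v ∈ openTrace (e * R.prod) (R.map (·⁻¹)).reverse := by
  induction R generalizing e with
  | nil => simpa [openTrace] using h
  | cons x R ih =>
    rw [List.prod_cons, ← mul_assoc] at *
    rw [List.map_cons, List.reverse_cons, openTrace_append, ← List.prod_inv_reverse,
      mul_inv_cancel_right, List.mem_append]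
    simp only [openTrace, List.mem_cons, List.not_mem_nil, or_false] at h ⊢
    have := ih (e * x)
    tauto

section
variable {G : Type*} [Group G] {S : Set G}

theorem ncard_union_image_mul {A : Type*} [CommGroup A] {F : Subgroup A}
    (hF : (F : Set A).Finite) {z : A} (hz : z ∉ F) :
    ((F : Set A) ∪ (· * z) '' F).ncard = 2 * (F : Set A).ncard := by
  rw [Set.ncard_union_eq ?_ hF (hF.image _), Set.ncard_image_of_injective _ (mul_left_injective z),
    two_mul]
  rw [Set.disjoint_left]
  rintro _ ha ⟨b, hb, rfl⟩
  exact hz ((Subgroup.mul_mem_cancel_left F hb).1 ha)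

theorem notMem_of_orderOf_eq_zero {A : Type*} [Group A] {F : Subgroup A}
    (hF : (F : Set A).Finite) {z : A} (hz : orderOf z = 0) : z ∉ F := by
  intro h
  have : Finite F := hF.to_subtype
  exact orderOf_eq_zero_iff.1 hz
    (by simpa using MonoidHom.isOfFinOrder F.subtype (isOfFinOrder_of_finite (⟨z, h⟩ : F)))

/-- A twisted cycle through `F ∪ F * z` with consecutive edges inside `F * z`, across, and inside
`F`. -/
theorem exists_twoWay_of_isTwistedCycle_union [Infinite (Abelianization G)] (hfin : S.Finite)
    (hgen : Subgroup.closure S = ⊤) {p : ℕ} (hp : p.Prime) (hc : Nat.card (commutator G) = p)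
    {F : Subgroup (Abelianization G)}
    (hF : (F : Set (Abelianization G)).Finite) {z : G} (hz : z ∈ letters S)
    (hzo : orderOf (Abelianization.of z) = 0) {V W : List G} {x y : G}
    (hV : Abelianization.of V.prod * (Abelianization.of z)⁻¹ ∈ F)
    (hx : Abelianization.of x ∈ F) (hy : Abelianization.of y ∈ F)
    (h : IsTwistedCycle S ((F : Set (Abelianization G)) ∪ (· * Abelianization.of z) '' F) 1
      (V ++ x :: z⁻¹ :: y :: W)) :
    ∃ x : ℤ → G, IsTwoWayHamiltonianPath (mulCayley S) x := by
  set v := Abelianization.of V.prod with hv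
  have hvx : v * Abelianization.of x * (Abelianization.of z)⁻¹ ∈ F := by
    rw [mul_right_comm]; exact mul_mem hV hx
  refine exists_twoWay_of_finite_subgroup_union hfin hgen hF hz hzo
    (a := v * Abelianization.of x * (Abelianization.of z)⁻¹ * Abelianization.of y)
    (b := v * Abelianization.of x * (Abelianization.of z)⁻¹)
    (c := v * Abelianization.of x) (d := v)
    (mul_mem hvx hy) hvx hvx hV ?_ ?_ ?_
  · have h' : IsTwistedCycle S ((F : Set (Abelianization G)) ∪ (· * Abelianization.of z) '' F) 1
        ((V ++ [x, z⁻¹]) ++ y :: W) := by simpa using h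
    exact (h'.trav hp hc (by simp [hv, mul_assoc]) rfl).symm
  · have h' : IsTwistedCycle S ((F : Set (Abelianization G)) ∪ (· * Abelianization.of z) '' F) 1
        ((V ++ [x]) ++ z⁻¹ :: y :: W) := by simpa using h
    exact (h'.trav hp hc (by simp [hv]) (by simp)).symm
  · exact (h.trav hp hc (by simp [hv]) rfl).symm

/-- A generator `t` of finite order `m` modulo `G'` with `t ^ m ≠ 1` traces a twisted cycle. -/
theorem exists_twoWay_of_pow_orderOf_ne_one [Infinite (Abelianization G)] (hfin : S.Finite)
    (hgen : Subgroup.closure S = ⊤) {p : ℕ} (hp : p.Prime) (hc : Nat.card (commutator G) = p)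
    {t : G} (ht : t ∈ letters S) (hto : 0 < orderOf (Abelianization.of t))
    (h1 : t ^ orderOf (Abelianization.of t) ≠ 1) :
    ∃ x : ℤ → G, IsTwoWayHamiltonianPath (mulCayley S) x := by
  set τ := Abelianization.of t with hτ
  have hF : (Subgroup.zpowers τ : Set (Abelianization G)).Finite :=
    finite_zpowers.2 (orderOf_pos_iff.1 hto)
  refine exists_twoWay_of_finite_subgroup (W := List.replicate (orderOf τ) t) hfin hgen hp hc hF
    (isTwistedCycle_of_ncard ?_ ?_ ?_ ?_ ?_)
  · intro x hx; rw [List.eq_of_mem_replicate hx]; exact ht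
  · intro a ha
    obtain ⟨j, hj, rfl⟩ := exists_pow_eq_of_mem_zpowers hto ha
    rw [List.map_replicate, ← one_mul (τ ^ j)]
    exact mul_pow_mem_openTrace_replicate _ _ hj
  · rw [List.length_replicate, ← Nat.card_coe_set_eq]
    exact (Nat.card_zpowers τ).ge
  · rw [List.prod_replicate, map_pow, ← hτ, pow_orderOf_eq_one]
  · rwa [List.prod_replicate]

/-- Noncommuting generators `s` and `t`, of infinite order and of finite order `m` modulo `G'`. The
word `s * t ^ (m - 1) * s⁻¹ * t ^ (1 - m)` traces a twisted cycle through `⟨t⟩ ∪ ⟨t⟩ * s`. -/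
theorem exists_twoWay_of_infinite_order_of_finite_order [Infinite (Abelianization G)]
    (hfin : S.Finite)
    (hgen : Subgroup.closure S = ⊤) {p : ℕ} (hp : p.Prime) (hc : Nat.card (commutator G) = p)
    {s t : G} (hs : s ∈ letters S) (ht : t ∈ letters S) (hso : orderOf (Abelianization.of s) = 0)
    (hto : 0 < orderOf (Abelianization.of t)) (h1 : t ^ orderOf (Abelianization.of t) = 1)
    (hst : ¬ Commute s t) :
    ∃ x : ℤ → G, IsTwoWayHamiltonianPath (mulCayley S) x := by
  set τ := Abelianization.of t with hτ
  set σ := Abelianization.of s with hσ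
  have hF : (Subgroup.zpowers τ : Set (Abelianization G)).Finite :=
    finite_zpowers.2 (orderOf_pos_iff.1 hto)
  have hσF := notMem_of_orderOf_eq_zero hF hso
  obtain ⟨n, hn⟩ : ∃ n, orderOf τ = n + 2 := by
    refine ⟨orderOf τ - 2, ?_⟩
    have : orderOf τ ≠ 1 := by
      intro h
      rw [h, pow_one] at h1
      exact hst (h1 ▸ Commute.one_right s)
    omega
  have hcard : (Subgroup.zpowers τ : Set (Abelianization G)).ncard = n + 2 := by
    rw [← hn, ← Nat.card_coe_set_eq]; exact Nat.card_zpowers τ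
  refine exists_twoWay_of_isTwistedCycle_union (V := s :: List.replicate n t) (x := t) (y := t⁻¹)
    (W := List.replicate n t⁻¹) hfin hgen hp hc hF hs hso ?_ (Subgroup.mem_zpowers _)
    (by rw [map_inv]; exact inv_mem (Subgroup.mem_zpowers _))
    (isTwistedCycle_of_ncard ?_ ?_ ?_ ?_ ?_)
  · rw [List.prod_cons, List.prod_replicate, map_mul, map_pow, ← hσ, mul_inv_cancel_comm]
    exact pow_mem (Subgroup.mem_zpowers _) _
  · intro y hy
    have hy' : y = s ∨ y = t ∨ y = s⁻¹ ∨ y = t⁻¹ := by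
      simp only [List.mem_append, List.mem_cons, List.mem_replicate] at hy
      tauto
    rcases hy' with rfl | rfl | rfl | rfl
    · exact hs
    · exact ht
    · exact inv_mem_letters.2 hs
    · exact inv_mem_letters.2 ht
  · have hw : (s :: List.replicate n t ++ t :: s⁻¹ :: t⁻¹ :: List.replicate n t⁻¹) =
        s :: (List.replicate (n + 1) t ++ s⁻¹ :: List.replicate (n + 1) t⁻¹) := by
      rw [List.replicate_succ', List.replicate_succ]; simp
    rw [hw]
    simp only [List.map_cons, List.map_append, List.map_replicate, map_inv, ← hσ, ← hτ, openTrace,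
      openTrace_append, List.prod_replicate, one_mul, List.mem_cons, List.mem_append,
      mul_inv_cancel_comm]
    rintro a (ha | ⟨a, ha, rfl⟩)
    · obtain ⟨j, hj, rfl⟩ := exists_pow_eq_of_mem_zpowers hto ha
      rcases Nat.eq_zero_or_pos j with rfl | hj0
      · simp
      · right; right; right
        have := mul_pow_mem_openTrace_replicate (τ ^ (n + 1)) τ⁻¹ (j := n + 1 - j) (n := n + 1)
          (by omega)
        rwa [inv_pow, ← pow_sub _ (by omega), Nat.sub_sub_self (by omega)] at this
    · obtain ⟨j, hj, rfl⟩ := exists_pow_eq_of_mem_zpowers hto ha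
      rcases Nat.lt_or_ge j (n + 1) with h | h
      · right; left
        simp only
        rw [mul_comm]
        exact mul_pow_mem_openTrace_replicate _ _ h
      · obtain rfl : j = n + 1 := by omega
        right; right; left
        exact mul_comm _ _
  · rw [ncard_union_image_mul hF hσF, hcard]
    simp; omega
  · simp only [List.prod_append, List.prod_cons, List.prod_replicate, map_mul, map_inv, map_pow]
    rw [inv_pow, ← mul_inv_cancel (σ * τ ^ n * τ), mul_inv, mul_inv]
    simp only [mul_assoc, mul_comm, mul_left_comm, ← hσ, ← hτ]
  · intro h
    apply hst
    simp only [List.prod_append, List.prod_cons, List.prod_replicate] at h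
    have h2 : t * t ^ (n + 1) = 1 := by rw [← pow_succ', ← hn]; exact h1
    have h3 : s * t ^ (n + 1) = t ^ (n + 1) * s := by
      rw [inv_pow] at h
      have h4 : s * (t ^ n * t) * s⁻¹ * (t⁻¹ * (t ^ n)⁻¹) = 1 := by simpa only [mul_assoc] using h
      rw [← mul_inv_rev, mul_inv_eq_one, mul_inv_eq_iff_eq_mul, ← pow_succ] at h4
      exact h4
    rw [mul_eq_one_iff_eq_inv'] at h2
    rw [h2] at h3
    have h5 : Commute s t⁻¹ := h3
    simpa using h5.inv_right

end

/-! ### Two generators of finite order modulo the commutator subgroup -/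

section
variable {G : Type*} [Group G] {S : Set G}

/-- Let `z` have infinite order modulo `G'`, and suppose that a closed walk `W` of even length,
together with a path `R` starting at the same vertex, runs through a finite subgroup `F`. Going
along `R`, then one step `z`, back along `R⁻¹`, and finally zigzagging along `W` is a closed walk
through `F ∪ F * z`. It is twisted if `W` is and `z` commutes with all letters. -/
theorem exists_twoWay_of_lollipop [Infinite (Abelianization G)] (hfin : S.Finite)
    (hgen : Subgroup.closure S = ⊤) {p : ℕ} (hp : p.Prime) (hc : Nat.card (commutator G) = p)
    {F : Subgroup (Abelianization G)}
    (hF : (F : Set (Abelianization G)).Finite) {z : G} (hz : z ∈ letters S)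
    (hzo : orderOf (Abelianization.of z) = 0) {W R : List G}
    (hl : ∀ y ∈ W ++ R, y ∈ letters S) (hWF : ∀ y ∈ W, Abelianization.of y ∈ F)
    (hcomm : ∀ y ∈ W ++ R, Commute z y) (heven : Even W.length)
    (hcov : ∀ a ∈ F, a ∈ openTrace 1 (W.map Abelianization.of) ∨
      a ∈ openTrace 1 (R.map Abelianization.of) ∨ a = Abelianization.of R.prod)
    (hlen : W.length + R.length ≤ (F : Set (Abelianization G)).ncard)
    (hclosed : Abelianization.of W.prod = 1) (htw : W.prod ≠ 1) :
    ∃ x : ℤ → G, IsTwoWayHamiltonianPath (mulCayley S) x := by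
  set ζ := Abelianization.of z with hζ
  obtain ⟨x, y, W, rfl⟩ : ∃ x y V, W = x :: y :: V := by
    match W, heven, htw with
    | [], _, h => exact absurd rfl h
    | [_], h, _ => exact absurd h (by simp)
    | x :: y :: V, _, _ => exact ⟨x, y, V, rfl⟩
  have hRc : Commute z R.prod :=
    Commute.list_prod_right _ _ fun c hc => hcomm c (List.mem_append_right _ hc)
  have hWc : Commute z (x :: y :: W).prod :=
    Commute.list_prod_right _ _ fun c hc => hcomm c (List.mem_append_left _ hc)
  have hyc : ∀ c ∈ y :: W, Commute z c :=
    fun c hc => hcomm c (List.mem_append_left _ (List.mem_cons_of_mem _ hc))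
  have hodd : ¬ Even (y :: W).length := by
    rw [List.length_cons, Nat.even_add_one] at heven; exact heven
  have hpre : (R ++ z :: (R.map (·⁻¹)).reverse).prod = z := by
    rw [List.prod_append, List.prod_cons, ← List.prod_inv_reverse, ← mul_assoc, ← hRc.eq,
      mul_inv_cancel_right]
  have hprod : (R ++ z :: (R.map (·⁻¹)).reverse ++ x :: zigzag z (y :: W)).prod =
      (x :: y :: W).prod := by
    rw [List.prod_append, hpre, List.prod_cons, prod_zigzag hyc, if_neg hodd, ← mul_assoc x,
      ← List.prod_cons, ← mul_assoc, hWc.eq, mul_inv_cancel_right]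
  refine exists_twoWay_of_isTwistedCycle_union (V := R ++ z :: (R.map (·⁻¹)).reverse) (x := x)
    (y := y) (W := zigzag z⁻¹ W) hfin hgen hp hc hF hz hzo ?_ (hWF _ (by simp)) (hWF _ (by simp))
    (isTwistedCycle_of_ncard ?_ ?_ ?_ ?_ ?_)
  · rw [hpre, ← hζ, mul_inv_cancel]; exact one_mem F
  · have hR : ∀ c ∈ R, c ∈ letters S := fun c hc => hl c (List.mem_append_right _ hc)
    have hW : ∀ c ∈ x :: y :: W, c ∈ letters S := fun c hc => hl c (List.mem_append_left _ hc)
    intro c hc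
    change c ∈ R ++ z :: (R.map (·⁻¹)).reverse ++ x :: zigzag z (y :: W) at hc
    rw [List.mem_append, List.mem_append, List.mem_cons, List.mem_cons, List.mem_reverse,
      List.mem_map] at hc
    rcases hc with (hc | rfl | ⟨c, hc, rfl⟩) | rfl | hc
    · exact hR c hc
    · exact hz
    · exact inv_mem_letters.2 (hR c hc)
    · exact hW _ (by simp)
    · rcases mem_zigzag hc with rfl | rfl | hc
      · exact hz
      · exact inv_mem_letters.2 hz
      · exact hW c (List.mem_cons_of_mem _ hc)
  · change ∀ a ∈ _, a ∈ openTrace 1 ((R ++ z :: (R.map (·⁻¹)).reverse ++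
      x :: zigzag z (y :: W)).map Abelianization.of)
    set ρ := R.map Abelianization.of with hρ
    have hρp : Abelianization.of R.prod = ρ.prod := map_list_prod _ _
    have hmap : ((R.map (·⁻¹)).reverse).map Abelianization.of = (ρ.map (·⁻¹)).reverse := by
      rw [List.map_reverse, hρ, List.map_map, List.map_map]
      congr 1
    have hpre' : (ρ ++ ζ :: (ρ.map (·⁻¹)).reverse).prod = ζ := by
      rw [← hmap, hρ, hζ, ← List.map_cons, ← List.map_append, ← map_list_prod, hpre]
    have key : ∀ a, a ∈ openTrace 1 ((R ++ z :: (R.map (·⁻¹)).reverse ++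
        x :: zigzag z (y :: W)).map Abelianization.of) ↔
        (a ∈ openTrace 1 ρ ∨ a = ρ.prod ∨ a ∈ openTrace (ζ * ρ.prod) (ρ.map (·⁻¹)).reverse) ∨
        a = ζ ∨ a ∈ openTrace (ζ * Abelianization.of x)
          (zigzag ζ ((y :: W).map Abelianization.of)) := by
      intro a
      rw [List.map_append, List.map_append, List.map_cons, List.map_cons, map_zigzag, hmap, ← hρ,
        ← hζ, openTrace_append, hpre', openTrace_append, List.mem_append, List.mem_append,
        openTrace, openTrace, List.mem_cons, List.mem_cons, one_mul, one_mul, mul_comm ζ ρ.prod]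
    have h1 : (1 : Abelianization G) ∈ openTrace 1 ρ ∨ (1 : Abelianization G) = ρ.prod := by
      cases ρ with
      | nil => simp
      | cons => simp [openTrace]
    rintro a (ha | ⟨a, ha, rfl⟩)
    · rw [key]
      rcases hcov a ha with h | h | h
      · rw [List.map_cons, openTrace, List.mem_cons, one_mul] at h
        rcases h with rfl | h
        · tauto
        · right; right
          have h' : ζ * a ∈ openTrace (ζ * Abelianization.of x)
              ((y :: W).map Abelianization.of) := by
            rw [openTrace_mul]; exact List.mem_map_of_mem h
          have := (mem_openTrace_zigzag ζ _ _ _ h').2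
          rwa [mul_inv_cancel_comm] at this
      · tauto
      · rw [hρp] at h; tauto
    · simp only
      rw [key, mul_comm a]
      have hR : a ∈ openTrace 1 ρ ∨ a = 1 * ρ.prod →
          a = 1 ∨ a ∈ openTrace (1 * ρ.prod) (ρ.map (·⁻¹)).reverse :=
        mem_openTrace_reverse ρ 1 a
      rw [one_mul] at hR
      have hR' : a ∈ openTrace 1 ρ ∨ a = ρ.prod →
          ζ * a = ζ ∨ ζ * a ∈ openTrace (ζ * ρ.prod) (ρ.map (·⁻¹)).reverse := by
        intro h
        rcases hR h with rfl | h
        · left; rw [mul_one]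
        · right; rw [openTrace_mul]; exact List.mem_map_of_mem h
      rcases hcov a ha with h | h | h
      · rw [List.map_cons, openTrace, List.mem_cons, one_mul] at h
        rcases h with rfl | h
        · right; left; rw [mul_one]
        · right; right
          have h' : ζ * a ∈ openTrace (ζ * Abelianization.of x)
              ((y :: W).map Abelianization.of) := by
            rw [openTrace_mul]; exact List.mem_map_of_mem h
          exact (mem_openTrace_zigzag ζ _ _ _ h').1
      · have := hR' (Or.inl h); tauto
      · rw [hρp] at h
        have := hR' (Or.inr h); tauto
  · rw [ncard_union_image_mul hF (notMem_of_orderOf_eq_zero hF hzo)]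
    change (R ++ z :: (R.map (·⁻¹)).reverse ++ x :: zigzag z (y :: W)).length ≤ _
    simp only [List.length_append, List.length_cons, List.length_reverse, List.length_map,
      length_zigzag] at hlen ⊢
    omega
  · change Abelianization.of (R ++ z :: (R.map (·⁻¹)).reverse ++ x :: zigzag z (y :: W)).prod = 1
    rw [hprod, hclosed]
  · change (R ++ z :: (R.map (·⁻¹)).reverse ++ x :: zigzag z (y :: W)).prod ≠ 1
    rwa [hprod]

theorem mul_card_le_ncard_sup_zpowers {A : Type*} [CommGroup A] {s t : A}
    (hF : ((Subgroup.zpowers t ⊔ Subgroup.zpowers s : Subgroup A) : Set A).Finite) :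
    orderOf (s : A ⧸ Subgroup.zpowers t) * orderOf t ≤
      ((Subgroup.zpowers t ⊔ Subgroup.zpowers s : Subgroup A) : Set A).ncard := by
  rw [Set.ncard_eq_toFinset_card _ hF, ← Finset.card_range (orderOf _ : ℕ),
    ← Finset.card_range (orderOf t), ← Finset.card_product]
  refine Finset.card_le_card_of_injOn (fun p => s ^ p.1 * t ^ p.2) ?_ ?_
  · rintro ⟨j, i⟩ -
    rw [Finset.mem_coe, Set.Finite.mem_toFinset]
    change s ^ j * t ^ i ∈ _
    rw [mul_comm]
    exact Subgroup.mul_mem_sup (Subgroup.pow_mem _ (Subgroup.mem_zpowers _) _)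
      (Subgroup.pow_mem _ (Subgroup.mem_zpowers _) _)
  · rintro ⟨j, i⟩ h ⟨j', i'⟩ h' e
    simp only [Finset.coe_product, Finset.coe_range, Set.mem_prod, Set.mem_Iio]
      at h h' e
    have hj : j = j' := by
      refine pow_injOn_Iio_orderOf (x := (s : A ⧸ Subgroup.zpowers t)) h.1 h'.1 ?_
      have := congrArg (QuotientGroup.mk (s := Subgroup.zpowers t)) e
      have hpow : ∀ n : ℕ, ((t ^ n : A) : A ⧸ Subgroup.zpowers t) = 1 := fun n =>
        (QuotientGroup.eq_one_iff _).2 (Subgroup.pow_mem _ (Subgroup.mem_zpowers _) _)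
      rwa [QuotientGroup.mk_mul, QuotientGroup.mk_mul, hpow, hpow, mul_one, mul_one] at this
    subst hj
    have hi : i = i' := pow_injOn_Iio_orderOf h.2 h'.2 (mul_left_cancel e)
    rw [hi]

theorem finite_sup_zpowers {A : Type*} [CommGroup A] {s t : A} (hs : 0 < orderOf s)
    (ht : 0 < orderOf t) :
    ((Subgroup.zpowers t ⊔ Subgroup.zpowers s : Subgroup A) : Set A).Finite := by
  refine ((finite_zpowers.2 (orderOf_pos_iff.1 ht)).mul
    (finite_zpowers.2 (orderOf_pos_iff.1 hs))).subset fun a ha => ?_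
  obtain ⟨b, hb, c, hc, rfl⟩ := Subgroup.mem_sup.1 ha
  exact Set.mul_mem_mul hb hc

/-- Noncommuting `s` and `t` of finite orders modulo `G'`, both commuting with a generator `z` of
infinite order, with `s` outside the subgroup generated by `t` modulo `G'`. The closed walk runs
through two cosets of `t`, and the path through the remaining ones. -/
theorem exists_twoWay_of_finite_order_of_notMem [Infinite (Abelianization G)] (hfin : S.Finite)
    (hgen : Subgroup.closure S = ⊤) {p : ℕ} (hp : p.Prime) (hc : Nat.card (commutator G) = p)
    {s t z : G} (hs : s ∈ letters S) (ht : t ∈ letters S) (hz : z ∈ letters S)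
    (hso : 0 < orderOf (Abelianization.of s))
    (hto : 0 < orderOf (Abelianization.of t)) (hzo : orderOf (Abelianization.of z) = 0)
    (h1 : t ^ orderOf (Abelianization.of t) = 1)
    (hst : ¬ Commute s t) (hzs : Commute z s) (hzt : Commute z t)
    (hmem : Abelianization.of s ∉ Subgroup.zpowers (Abelianization.of t)) :
    ∃ x : ℤ → G, IsTwoWayHamiltonianPath (mulCayley S) x := by
  set τ := Abelianization.of t with hτ
  set σ := Abelianization.of s with hσ
  have hF := finite_sup_zpowers hso hto
  have hcard := mul_card_le_ncard_sup_zpowers hF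
  have hmemn := fun j => zpow_mem_iff_orderOf_dvd (Subgroup.zpowers τ) σ j
  obtain ⟨n, hn⟩ : ∃ n, orderOf ((σ : Abelianization G) :
      Abelianization G ⧸ Subgroup.zpowers τ) = n + 2 := by
    refine ⟨orderOf ((σ : Abelianization G) : Abelianization G ⧸ Subgroup.zpowers τ) - 2, ?_⟩
    have h0 : orderOf ((σ : Abelianization G) : Abelianization G ⧸ Subgroup.zpowers τ) ≠ 0 := by
      intro h
      have := (hmemn (orderOf σ)).1 (by rw [zpow_natCast, pow_orderOf_eq_one]; exact one_mem _)
      rw [h, Nat.cast_zero, zero_dvd_iff, Nat.cast_eq_zero] at this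
      exact hso.ne' this
    have h2 : orderOf ((σ : Abelianization G) : Abelianization G ⧸ Subgroup.zpowers τ) ≠ 1 := by
      intro h
      exact hmem (by simpa [h] using hmemn 1)
    omega
  obtain ⟨a, ha⟩ : ∃ a, orderOf τ = a + 1 := ⟨orderOf τ - 1, by omega⟩
  rw [hn] at hmemn hcard
  rw [ha] at hcard h1
  have hlet : ∀ y ∈ (List.replicate a t ++ s⁻¹ :: (List.replicate a t⁻¹ ++ [s])) ++
      (List.replicate n (s :: List.replicate a t)).flatten,
      y = t ∨ y = t⁻¹ ∨ y = s ∨ y = s⁻¹ := by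
    intro y hy
    simp only [List.mem_append, List.mem_cons, List.mem_replicate, List.mem_flatten,
      List.not_mem_nil, or_false] at hy
    rcases hy with (hy | hy | hy | hy) | ⟨l, ⟨-, rfl⟩, hy⟩
    · tauto
    · tauto
    · tauto
    · tauto
    · simp only [List.mem_cons, List.mem_replicate] at hy
      tauto
  have hτF : τ ∈ Subgroup.zpowers τ ⊔ Subgroup.zpowers σ :=
    Subgroup.mem_sup_left (Subgroup.mem_zpowers _)
  have hσF : σ ∈ Subgroup.zpowers τ ⊔ Subgroup.zpowers σ :=
    Subgroup.mem_sup_right (Subgroup.mem_zpowers _)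
  have hred : ∀ y ∈ Subgroup.zpowers τ, ∃ i < a + 1, τ ^ i = y := by
    intro y hy
    rw [← ha]; exact exists_pow_eq_of_mem_zpowers hto hy
  refine exists_twoWay_of_lollipop (z := z)
    (W := List.replicate a t ++ s⁻¹ :: (List.replicate a t⁻¹ ++ [s]))
    (R := (List.replicate n (s :: List.replicate a t)).flatten) hfin hgen hp hc hF hz hzo
    ?_ ?_ ?_ ?_ ?_ ?_ ?_ ?_
  · intro y hy
    rcases hlet y hy with rfl | rfl | rfl | rfl
    · exact ht
    · exact inv_mem_letters.2 ht
    · exact hs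
    · exact inv_mem_letters.2 hs
  · intro y hy
    rcases hlet y (List.mem_append_left _ hy) with rfl | rfl | rfl | rfl
    · exact hτF
    · rw [map_inv]; exact inv_mem hτF
    · exact hσF
    · rw [map_inv]; exact inv_mem hσF
  · intro y hy
    rcases hlet y hy with rfl | rfl | rfl | rfl
    · exact hzt
    · exact hzt.inv_right
    · exact hzs
    · exact hzs.inv_right
  · exact ⟨a + 1, by simp; omega⟩
  · intro x hx
    obtain ⟨y, hy, _, ⟨c, rfl⟩, rfl⟩ := Subgroup.mem_sup.1 hx
    simp only [List.map_append, List.map_cons, List.map_replicate, map_inv, List.map_nil, ← hσ,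
      ← hτ, openTrace_append, List.prod_replicate, openTrace, one_mul, List.mem_append,
      List.mem_cons, List.not_mem_nil, or_false, List.map_flatten]
    have hpos : (0 : ℤ) < ((n + 2 : ℕ) : ℤ) := by omega
    have e1 := Int.emod_nonneg (c + 1) hpos.ne'
    have e2 := Int.emod_lt_of_pos (c + 1) hpos
    -- `J` is the representative of the exponent of `σ` between `-1` and `n`
    obtain ⟨J, hJ⟩ : ∃ J, J = (c + 1) % ((n + 2 : ℕ) : ℤ) - 1 := ⟨_, rfl⟩
    have hcJ : σ ^ (c - J) ∈ Subgroup.zpowers τ := by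
      rw [hmemn, hJ, show c - ((c + 1) % ((n + 2 : ℕ) : ℤ) - 1) =
        c + 1 - (c + 1) % ((n + 2 : ℕ) : ℤ) by ring]
      exact Int.dvd_self_sub_emod
    obtain ⟨y', hy', hyy⟩ : ∃ y' ∈ Subgroup.zpowers τ, y * σ ^ c = y' * σ ^ J :=
      ⟨y * σ ^ (c - J), mul_mem hy hcJ, by rw [mul_assoc, ← zpow_add, sub_add_cancel]⟩
    rw [hyy]
    rcases lt_trichotomy J 0 with h | h | h
    · left
      obtain rfl : J = -1 := by omega
      obtain ⟨i, hi, rfl⟩ := hred y' hy'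
      right; right
      rcases Nat.eq_zero_or_pos i with rfl | hi0
      · right; simp
      · left
        have := mul_pow_mem_openTrace_replicate (τ ^ a * σ⁻¹) τ⁻¹ (j := a - i) (n := a) (by omega)
        rw [mul_right_comm, inv_pow, ← pow_sub _ (by omega), Nat.sub_sub_self (by omega)] at this
        rwa [zpow_neg_one]
    · left
      subst h
      obtain ⟨i, hi, rfl⟩ := hred y' hy'
      rw [zpow_zero, mul_one]
      rcases Nat.lt_or_ge i a with h | h
      · left
        simpa using mul_pow_mem_openTrace_replicate 1 τ h
      · obtain rfl : i = a := by omega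
        right; left; rfl
    · right
      obtain ⟨k, rfl⟩ : ∃ k : ℕ, J = k + 1 := ⟨(J - 1).toNat, by omega⟩
      have hk : k < n := by omega
      obtain ⟨i, hi, hi'⟩ := hred (y' * ((τ ^ a) ^ k)⁻¹)
        (mul_mem hy' (inv_mem (pow_mem (pow_mem (Subgroup.mem_zpowers _) _) _)))
      rw [eq_mul_inv_iff_mul_eq] at hi'
      have hx' : y' * σ ^ ((k : ℤ) + 1) = (σ * τ ^ a) ^ k * σ * τ ^ i := by
        rw [← hi', zpow_add_one, zpow_natCast, mul_pow]
        simp only [mul_assoc, mul_comm, mul_left_comm]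
      rw [hx']
      have hblock : ∀ x, x ∈ openTrace 1 (List.replicate n (σ :: List.replicate a τ)).flatten ↔
          ∃ k < n, x ∈ openTrace ((σ * τ ^ a) ^ k) (σ :: List.replicate a τ) := by
        intro x
        rw [mem_openTrace_flatten_replicate]
        simp
      rw [hblock]
      rcases Nat.lt_or_ge i a with h | h
      · left
        refine ⟨k, hk, ?_⟩
        rw [openTrace]
        exact List.mem_cons_of_mem _ (mul_pow_mem_openTrace_replicate _ _ h)
      · obtain rfl : i = a := by omega
        rw [mul_assoc, ← pow_succ]
        rcases Nat.lt_or_ge (k + 1) n with h | h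
        · left
          exact ⟨k + 1, h, by simp [openTrace]⟩
        · right
          obtain rfl : n = k + 1 := by omega
          simp [List.prod_flatten, ← hσ, ← hτ]
  · refine le_trans (le_of_eq ?_) hcard
    simp
    ring
  · simp only [List.prod_append, List.prod_cons, List.prod_replicate, List.prod_nil, map_mul,
      map_inv, map_pow, ← hσ, ← hτ, mul_one]
    rw [inv_pow, ← mul_inv_cancel (τ ^ a * σ), mul_inv]
    simp only [mul_assoc, mul_comm, mul_left_comm]
  · intro h
    apply hst
    simp only [List.prod_append, List.prod_cons, List.prod_replicate, List.prod_nil, mul_one]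
      at h
    rw [pow_succ, mul_eq_one_iff_eq_inv] at h1
    rw [inv_pow, h1, inv_inv] at h
    have h2 : (s * t)⁻¹ * (t * s) = 1 := by simpa [mul_assoc] using h
    exact inv_mul_eq_one.1 h2

/-- Noncommuting `s` and `t`, both commuting with a generator `z` of infinite order modulo `G'`,
with `s` congruent to an odd power of `t`, which has finite order. The closed walk of the lollipop
is `t ^ (-k) * s`. -/
theorem exists_twoWay_of_eq_odd_pow [Infinite (Abelianization G)] (hfin : S.Finite)
    (hgen : Subgroup.closure S = ⊤) {p : ℕ} (hp : p.Prime) (hc : Nat.card (commutator G) = p)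
    {s t z : G} (hs : s ∈ letters S) (ht : t ∈ letters S) (hz : z ∈ letters S)
    (hzo : orderOf (Abelianization.of z) = 0)
    (hst : ¬ Commute s t) (hzs : Commute z s) (hzt : Commute z t) {k : ℕ} (hk : Odd k)
    (hkt : k < orderOf (Abelianization.of t))
    (h : Abelianization.of s = Abelianization.of t ^ k) :
    ∃ x : ℤ → G, IsTwoWayHamiltonianPath (mulCayley S) x := by
  set τ := Abelianization.of t with hτ
  have hto : 0 < orderOf τ := by omega
  have hF : (Subgroup.zpowers τ : Set (Abelianization G)).Finite :=
    finite_zpowers.2 (orderOf_pos_iff.1 hto)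
  obtain ⟨r, hr⟩ : ∃ r, orderOf τ = k + 1 + r := ⟨orderOf τ - (k + 1), by omega⟩
  have hcard : (Subgroup.zpowers τ : Set (Abelianization G)).ncard = k + 1 + r := by
    rw [← hr, ← Nat.card_coe_set_eq]; exact Nat.card_zpowers τ
  have hlet : ∀ y ∈ (List.replicate k t⁻¹ ++ [s]) ++ List.replicate r t,
      y = t ∨ y = t⁻¹ ∨ y = s := by
    intro y hy
    simp only [List.mem_append, List.mem_cons, List.mem_replicate, List.not_mem_nil,
      or_false] at hy
    tauto
  have hτF := Subgroup.mem_zpowers τ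
  refine exists_twoWay_of_lollipop (z := z) (W := List.replicate k t⁻¹ ++ [s])
    (R := List.replicate r t) hfin hgen hp hc hF hz hzo ?_ ?_ ?_ ?_ ?_ ?_ ?_ ?_
  · intro y hy
    rcases hlet y hy with rfl | rfl | rfl
    · exact ht
    · exact inv_mem_letters.2 ht
    · exact hs
  · intro y hy
    rcases hlet y (List.mem_append_left _ hy) with rfl | rfl | rfl
    · exact hτF
    · rw [map_inv]; exact inv_mem hτF
    · rw [h]; exact pow_mem hτF _
  · intro y hy
    rcases hlet y hy with rfl | rfl | rfl
    · exact hzt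
    · exact hzt.inv_right
    · exact hzs
  · simpa using hk.add_one
  · intro x hx
    obtain ⟨i, hi, rfl⟩ := exists_pow_eq_of_mem_zpowers hto hx
    simp only [List.map_append, List.map_cons, List.map_replicate, map_inv, List.map_nil,
      ← hτ, openTrace_append, List.prod_replicate, openTrace, one_mul, List.mem_append,
      List.mem_cons, List.not_mem_nil, or_false, map_pow]
    rcases lt_trichotomy i r with hir | rfl | hir
    · right; left
      simpa using mul_pow_mem_openTrace_replicate 1 τ hir
    · tauto
    · left
      have hinv : τ ^ i = τ⁻¹ ^ (orderOf τ - i) := by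
        rw [inv_pow, pow_sub _ hi.le, pow_orderOf_eq_one, one_mul, inv_inv]
      rw [hinv]
      rcases Nat.lt_or_ge (orderOf τ - i) k with hik | hik
      · left
        simpa using mul_pow_mem_openTrace_replicate 1 τ⁻¹ hik
      · right
        congr 1; omega
  · rw [hcard]; simp
  · simp only [List.prod_append, List.prod_replicate, map_mul, map_inv, map_pow, ← hτ,
      List.prod_singleton, h]
    rw [inv_pow, inv_mul_cancel]
  · intro h'
    simp only [List.prod_append, List.prod_replicate, List.prod_singleton] at h'
    rw [inv_pow, inv_mul_eq_one] at h'
    exact hst (h' ▸ (Commute.refl t).pow_left k)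

/-- Noncommuting generators `s` and `t` of finite order modulo `G'`, both commuting with a
generator `z` of infinite order. -/
theorem exists_twoWay_of_finite_order_of_finite_order [Infinite (Abelianization G)]
    (hfin : S.Finite)
    (hgen : Subgroup.closure S = ⊤) {p : ℕ} (hp : p.Prime) (hc : Nat.card (commutator G) = p)
    {s t z : G} (hs : s ∈ letters S) (ht : t ∈ letters S) (hz : z ∈ letters S)
    (hso : 0 < orderOf (Abelianization.of s))
    (hto : 0 < orderOf (Abelianization.of t)) (hzo : orderOf (Abelianization.of z) = 0)
    (hs1 : s ^ orderOf (Abelianization.of s) = 1) (ht1 : t ^ orderOf (Abelianization.of t) = 1)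
    (hst : ¬ Commute s t) (hzs : Commute z s) (hzt : Commute z t) :
    ∃ x : ℤ → G, IsTwoWayHamiltonianPath (mulCayley S) x := by
  by_cases h1 : Abelianization.of s ∈ Subgroup.zpowers (Abelianization.of t)
  swap
  · exact exists_twoWay_of_finite_order_of_notMem hfin hgen hp hc hs ht hz hso hto hzo ht1 hst
      hzs hzt h1
  by_cases h2 : Abelianization.of t ∈ Subgroup.zpowers (Abelianization.of s)
  swap
  · exact exists_twoWay_of_finite_order_of_notMem hfin hgen hp hc ht hs hz hto hso hzo hs1
      (fun h => hst h.symm) hzt hzs h2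
  obtain ⟨k, hk, hks⟩ := exists_pow_eq_of_mem_zpowers hto h1
  rcases Nat.even_or_odd k with he | ho
  swap
  · exact exists_twoWay_of_eq_odd_pow hfin hgen hp hc hs ht hz hzo hst hzs hzt ho hk hks.symm
  -- for even `k` the order of `t` is odd, and `s⁻¹` is an odd power of `t`
  have hodd : Odd (orderOf (Abelianization.of t)) := by
    obtain ⟨l, -, hl⟩ := exists_pow_eq_of_mem_zpowers hso h2
    rw [← hks, ← pow_mul] at hl
    by_contra h
    rw [Nat.not_odd_iff_even] at h
    have h3 := (pow_eq_pow_iff_modEq (x := Abelianization.of t) (n := k * l) (m := 1)).1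
      (by rw [hl, pow_one])
    have h4 := h3.of_dvd h.two_dvd
    have h5 : k * l % 2 = 0 := Nat.even_iff.1 (he.mul_right l)
    rw [Nat.ModEq, h5] at h4
    omega
  have hk0 : 0 < k := by
    rcases Nat.eq_zero_or_pos k with rfl | h
    · rw [pow_zero] at hks
      rw [← hks, orderOf_one, pow_one] at hs1
      exact absurd (hs1 ▸ Commute.one_left t) hst
    · exact h
  refine exists_twoWay_of_eq_odd_pow (s := s⁻¹) (k := orderOf (Abelianization.of t) - k) hfin hgen
    hp hc (inv_mem_letters.2 hs) ht hz hzo (fun h => hst (by simpa using h.inv_left))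
    hzs.inv_right hzt (Nat.Odd.sub_even hk.le hodd he) (by omega) ?_
  rw [map_inv, ← hks, pow_sub _ hk.le, pow_orderOf_eq_one, one_mul]

end

/-! ### Existence of a two-way hamiltonian path -/

theorem infinite_abelianization {G : Type*} [Group G] [Infinite G] [Finite (commutator G)] :
    Infinite (Abelianization G) := by
  by_contra h
  rw [not_infinite_iff_finite] at h
  have h' : Finite (G ⧸ commutator G) := h
  have := Finite.of_equiv _ (Subgroup.groupEquivQuotientProdSubgroup (s := commutator G)).symm
  exact not_finite G

theorem exists_not_commute_of_commutator_ne_bot {G : Type*} [Group G] {S : Set G}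
    (hgen : Subgroup.closure S = ⊤) (h : commutator G ≠ ⊥) : ∃ s ∈ S, ∃ t ∈ S, ¬ Commute s t := by
  by_contra! hcon
  apply h
  rw [commutator_eq_bot_iff_center_eq_top, eq_top_iff]
  have h1 : (⊤ : Subgroup G) ≤ Subgroup.centralizer S := by
    rw [← hgen, Subgroup.closure_le]
    exact fun s hs t ht => hcon t ht s hs
  have h2 : (⊤ : Subgroup G) ≤ Subgroup.centralizer Set.univ := by
    rw [← hgen, Subgroup.closure_le]
    exact fun s hs t _ => (h1 (x := t) trivial s hs).symm
  rwa [Subgroup.centralizer_univ] at h2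

theorem exists_orderOf_eq_zero {G : Type*} [Group G] [Infinite (Abelianization G)] {S : Set G}
    (hfin : S.Finite) (hgen : Subgroup.closure S = ⊤) :
    ∃ z ∈ S, orderOf (Abelianization.of z) = 0 := by
  by_contra! hcon
  have hclo := closure_image_abelianization hgen
  have hfg : Group.FG (Abelianization G) := Group.fg_iff.2 ⟨_, hclo, hfin.image _⟩
  have := CommGroup.finite_of_fg_isMulTorsion (Abelianization G) fun a => by
    have ha : a ∈ Subgroup.closure (Abelianization.of '' S) := by rw [hclo]; trivial
    induction ha using Subgroup.closure_induction with
    | mem a ha =>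
      obtain ⟨s, hs, rfl⟩ := ha
      by_contra h
      exact hcon s hs (orderOf_eq_zero_iff.2 h)
    | one => exact IsOfFinOrder.one
    | mul a b _ _ iha ihb => exact iha.mul ihb
    | inv a _ ih => exact ih.inv
  exact not_finite (Abelianization G)

theorem mainTheorem1 {G : Type*} [Group G] [Infinite G]
    (S : Set G) (hfin : S.Finite) (hgen : Subgroup.closure S = ⊤)
    (p : ℕ) (hp : p.Prime)
    (hG' : Nonempty (commutator G ≃* Multiplicative (ZMod p))) :
    ∃ x : ℤ → G, IsTwoWayHamiltonianPath (SimpleGraph.mulCayley S) x := by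
  obtain ⟨φ⟩ := hG'
  have hc : Nat.card (commutator G) = p := by
    rw [Nat.card_congr φ.toEquiv]
    exact Nat.card_zmod p
  have hfc : Finite (commutator G) := Nat.finite_of_card_ne_zero (by rw [hc]; exact hp.ne_zero)
  have hA : Infinite (Abelianization G) := infinite_abelianization
  obtain ⟨s, hs, t, ht, hst⟩ := exists_not_commute_of_commutator_ne_bot hgen (by
    intro h
    rw [h, Subgroup.card_bot] at hc
    exact hp.one_lt.ne hc)
  obtain ⟨z, hz, hzo⟩ := exists_orderOf_eq_zero hfin hgen
  by_cases h0 : ∀ t ∈ S, 0 < orderOf (Abelianization.of t) →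
      t ^ orderOf (Abelianization.of t) = 1
  swap
  · push Not at h0
    obtain ⟨t, ht, hto, h1⟩ := h0
    exact exists_twoWay_of_pow_orderOf_ne_one hfin hgen hp hc (subset_letters ht) hto h1
  have mixed : ∀ s ∈ S, ∀ t ∈ S, orderOf (Abelianization.of s) = 0 →
      0 < orderOf (Abelianization.of t) → ¬ Commute s t →
      ∃ x : ℤ → G, IsTwoWayHamiltonianPath (SimpleGraph.mulCayley S) x :=
    fun s hs t ht hso hto hst => exists_twoWay_of_infinite_order_of_finite_order hfin hgen hp hc
      (subset_letters hs) (subset_letters ht) hso hto (h0 t ht hto) hst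
  rcases Nat.eq_zero_or_pos (orderOf (Abelianization.of s)) with hso | hso <;>
    rcases Nat.eq_zero_or_pos (orderOf (Abelianization.of t)) with hto | hto
  · exact exists_twoWay_of_infinite_order_of_infinite_order hfin hgen hp hc (subset_letters hs)
      (subset_letters ht) hso hto hst
  · exact mixed s hs t ht hso hto hst
  · exact mixed t ht s hs hto hso fun h => hst h.symm
  · by_cases hzs : Commute z s
    · by_cases hzt : Commute z t
      · exact exists_twoWay_of_finite_order_of_finite_order hfin hgen hp hc (subset_letters hs)
          (subset_letters ht) (subset_letters hz) hso hto hzo (h0 s hs hso) (h0 t ht hto) hst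
          hzs hzt
      · exact mixed z hz t ht hzo hto hzt
    · exact mixed z hz s hs hzo hso hzs
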